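/- Let $\ell_1,\dots,\ell_n:\mathbb{R}^d\times Z\to\mathbb{R}$ ($n\ge 1$) be losses, twice differentiable in the first argument, let $\mathbf D_1,\dots,\mathbf D_n$ be probability distributions on $Z$, let $\mathcal L_i(\mathbf w)=\mathbb E_{\mathbf z\sim\mathbf D_i}[\ell_i(\mathbf w;\mathbf z)]$, and let $F(\mathbf w)=\frac1n\sum_{i=1}^n\mathcal L_i(\mathbf w-\alpha\nabla\mathcal L_i(\mathbf w))$ with $\alpha>0$. Assume that for all $i$ and all $\mathbf w,\mathbf w'\in\mathbb{R}^d$: - $\mathcal L_i$ is $C^2$, $\|\nabla\mathcal L_i(\mathbf w)-\nabla\mathcal L_i(\mathbf w')\|\le L\|\mathbf w-\mathbf w'\|$ and $\|\nabla^2\mathcal L_i(\mathbf w)-\nabla^2\mathcal L_i(\mathbf w')\|\le\rho\|\mathbf w-\mathbf w'\|$ (spectral norm); - $\nabla\ell_i(\mathbf w;\mathbf z)$ and $\nabla^2\ell_i(\mathbf w;\mathbf z)$, $\mathbf z\sim\mathbf D_i$, are unbiased for $\nabla\mathcal L_i(\mathbf w)$ and $\nabla^2\mathcal L_i(\mathbf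 w)$, with $\mathbb E\|\nabla\ell_i(\mathbf w;\mathbf z)-\nabla\mathcal L_i(\mathbf w)\|^2\le\sigma_G^2$ and $\mathbb E\|\nabla^2\ell_i(\mathbf w;\mathbf z)-\nabla^2\mathcal L_i(\mathbf w)\|^2\le\sigma_H^2$; - $F$ is bounded below, and $\|\nabla\mathcal L_i(\mathbf w)\|\le G$. Given $\mathbf w_0\in\mathbb{R}^d$, the algorithm $\mathrm{MOML}^{\mathrm{v1}}$ with task batch size $B$, data batch size $K$, step size $\eta$ and momentum factor $\beta$ does the following for $t=0,\dots,T-1$. It draws a set $\mathcal B_t$ of $B$ tasks uniformly at random and, for every $i\in\mathcal B_t$, three batches $\mathcal S_1^i,\mathcal S_2^i,\mathcal S_3^i$ of $K$ samples from $\mathbf D_i$, all draws being independent of each other and of the past. With $\widehat\nabla_{\mathcal S}\mathcal L_i=\frac1K\sum_{\mathbf z\in\mathcal S}\nabla\ell_i(\cdot;\mathbf z)$ and $\widehat\nabla^2_{\mathcal S}\mathcal L_i=\frac1K\sum_{\mathbf z\in\mathcal S}\nabla^2\ell_i(\cdot;\mathbf z)$, it sets $\widehat{\mathbf v}_t^i=\mathbf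 w_t-\alpha\widehat\nabla_{\mathcal S_1^i}\mathcal L_i(\mathbf w_t)$ for $i\in\mathcal B_t$; $$\mathbf u_{t+1}^i=(1-\beta)\mathbf u_t^i+\beta\widehat{\mathbf v}_t^i\quad(i\in\mathcal B_t),\qquad \mathbf u_{t+1}^i=\mathbf u_t^i\quad(i\notin\mathcal B_t),$$ except that $\mathbf u_{t+1}^i=\widehat{\mathbf v}_t^i$ if $t$ is the first iteration in which task $i$ is sampled (this initializes $\mathbf u^i$); and $$\mathbf w_{t+1}=\mathbf w_t-\eta\,\frac1B\sum_{i\in\mathcal B_t}\bigl(I-\alpha\widehat\nabla^2_{\mathcal S_2^i}\mathcal L_i(\mathbf w_t)\bigr)\widehat\nabla_{\mathcal S_3^i}\mathcal L_i(\mathbf u_{t+1}^i).$$ **Theorem.** For all $\alpha,G>0$ and $L,\rho,\sigma_G,\sigma_H,\Delta_0\ge0$ there is a constant $C>0$, depending only on these numbers (in particular neither on $n$, $d$, the losses and the distributions, nor on $\epsilon$ and $T$), such that the following holds for all $n\ge1$, $\epsilon>0$ and all integers $T\ge C\,n\,\epsilon^{-5}$. Let $B=K=1$, $\eta=\frac{B^{2/5}}{n^{2/5}T^{3/5}}$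 and $\beta=\frac{n^{2/5}}{B^{2/5}T^{2/5}}$. If $\epsilon\le1$, then $\beta<1$. Whenever $\beta<1$, for all losses, distributions and $\mathbf w_0$ as above with $F(\mathbf w_0)-\inf F\le\Delta_0$, the iterates of $\mathrm{MOML}^{\mathrm{v1}}$ satisfy $$\mathbb E\,\|\nabla F(\mathbf w_\tau)\|\le\epsilon,$$ where $\tau$ is uniform on $\{0,\dots,T-1\}$ and independent of the algorithm's randomness. That is, $\mathrm{MOML}^{\mathrm{v1}}$ with these parameters finds an $\epsilon$-stationary point in $T=\mathcal O(n\epsilon^{-5})$ iterations. -/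

import Mathlib

open MeasureTheory ProbabilityTheory
open scoped Gradient

noncomputable section

namespace MOML

/-- The parameter space `ℝ^d` with the Euclidean norm. -/
abbrev Vec (d : ℕ) := EuclideanSpace ℝ (Fin d)

/-- The Hessian of `f` at `w`, as an operator on `ℝ^d`; its operator norm is the spectral norm. -/
def hess {d : ℕ} (f : Vec d → ℝ) (w : Vec d) : Vec d →L[ℝ] Vec d :=
  fderiv ℝ (∇ f) w

section Objective

variable {d n : ℕ} {Z : Type*} [MeasurableSpace Z]

/-- The risk of task `i`: `𝓛ᵢ(w) = 𝔼_{z ∼ Dᵢ} ℓᵢ(w; z)`. -/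
def risk (ℓ : Fin n → Vec d → Z → ℝ) (D : Fin n → Measure Z) (i : Fin n) (w : Vec d) : ℝ :=
  ∫ z, ℓ i w z ∂(D i)

/-- The MAML objective `F(w) = (1/n) ∑ᵢ 𝓛ᵢ(w - α ∇𝓛ᵢ(w))`. -/
def metaObjective (α : ℝ) (ℓ : Fin n → Vec d → Z → ℝ) (D : Fin n → Measure Z) (w : Vec d) : ℝ :=
  (n : ℝ)⁻¹ * ∑ i, risk ℓ D i (w - α • ∇ (risk ℓ D i) w)

/-- The standing assumptions on the losses `ℓᵢ` and the data distributions `Dᵢ`. -/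
structure Assumptions (α L ρ G σG σH : ℝ) (ℓ : Fin n → Vec d → Z → ℝ)
    (D : Fin n → Measure Z) : Prop where
  /-- The losses are twice differentiable in the parameter, and the stochastic gradients and
  Hessians are measurable. -/
  loss_diff : ∀ i z, Differentiable ℝ (fun w => ℓ i w z)
  loss_grad_diff : ∀ i z, Differentiable ℝ (∇ (fun w => ℓ i w z))
  grad_measurable : ∀ i, Measurable (fun p : Vec d × Z => ∇ (fun w => ℓ i w p.2) p.1)
  hess_measurable : ∀ i, Measurable (fun p : Vec d × Z => hess (fun w => ℓ i w p.2) p.1)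
  /-- The risks are well defined, and stochastic gradients and Hessians are unbiased. -/
  loss_integrable : ∀ i w, Integrable (fun z => ℓ i w z) (D i)
  grad_unbiased : ∀ i w, ∫ z, ∇ (fun w' => ℓ i w' z) w ∂(D i) = ∇ (risk ℓ D i) w
  hess_unbiased : ∀ i w, ∫ z, hess (fun w' => ℓ i w' z) w ∂(D i) = hess (risk ℓ D i) w
  /-- Smoothness of the risks. -/
  risk_contDiff : ∀ i, ContDiff ℝ 2 (risk ℓ D i)
  grad_lipschitz : ∀ i w w', ‖∇ (risk ℓ D i) w - ∇ (risk ℓ D i) w'‖ ≤ L * ‖w - w'‖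
  hess_lipschitz : ∀ i w w', ‖hess (risk ℓ D i) w - hess (risk ℓ D i) w'‖ ≤ ρ * ‖w - w'‖
  /-- Bounded variance. -/
  grad_sq_integrable : ∀ i w,
    Integrable (fun z => ‖∇ (fun w' => ℓ i w' z) w - ∇ (risk ℓ D i) w‖ ^ 2) (D i)
  grad_variance : ∀ i w,
    ∫ z, ‖∇ (fun w' => ℓ i w' z) w - ∇ (risk ℓ D i) w‖ ^ 2 ∂(D i) ≤ σG ^ 2
  hess_sq_integrable : ∀ i w,
    Integrable (fun z => ‖hess (fun w' => ℓ i w' z) w - hess (risk ℓ D i) w‖ ^ 2) (D i)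
  hess_variance : ∀ i w,
    ∫ z, ‖hess (fun w' => ℓ i w' z) w - hess (risk ℓ D i) w‖ ^ 2 ∂(D i) ≤ σH ^ 2
  /-- `F` is bounded below. -/
  bddBelow : BddBelow (Set.range (metaObjective α ℓ D))
  /-- Bounded gradients. -/
  grad_bounded : ∀ i w, ‖∇ (risk ℓ D i) w‖ ≤ G

end Objective

section Sampling

/-- A batch of `B` distinct tasks among `n`. -/
def TaskBatch (n B : ℕ) : Type := {s : Finset (Fin n) // s.card = B}

instance (n B : ℕ) : MeasurableSpace (TaskBatch n B) := ⊤

/-- `K` data points for each of the `n` tasks. The algorithm below reads only those of the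
sampled tasks. -/
abbrev DataBatch (n K : ℕ) (Z : Type*) := Fin n → Fin K → Z

/-- The randomness of one iteration: the task batch `𝓑ₜ` and the data batches `𝓢₁, 𝓢₂, 𝓢₃`. -/
abbrev StepSample (n B K : ℕ) (Z : Type*) :=
  TaskBatch n B × DataBatch n K Z × DataBatch n K Z × DataBatch n K Z

/-- The law of a data batch: independent points, those of task `i` distributed as `Dᵢ`. -/
def dataLaw {n : ℕ} (K : ℕ) {Z : Type*} [MeasurableSpace Z] (D : Fin n → Measure Z) :
    Measure (DataBatch n K Z) :=
  Measure.pi fun i => Measure.pi fun _ => D i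

/-- The law of the randomness of one iteration: `𝓑ₜ` is uniform among the sets of `B` tasks, and
`𝓑ₜ, 𝓢₁, 𝓢₂, 𝓢₃` are independent. -/
def stepLaw {n : ℕ} (B K : ℕ) {Z : Type*} [MeasurableSpace Z] (D : Fin n → Measure Z) :
    Measure (StepSample n B K Z) :=
  (uniformOn (Set.univ : Set (TaskBatch n B))).prod
    ((dataLaw K D).prod ((dataLaw K D).prod (dataLaw K D)))

end Sampling

section Algorithm

variable {d n B K : ℕ} {Z : Type*}

/-- The mini-batch gradient of a loss. -/
def batchGrad (f : Vec d → Z → ℝ) (S : Fin K → Z) (w : Vec d) : Vec d :=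
  (K : ℝ)⁻¹ • ∑ k, ∇ (fun w' => f w' (S k)) w

/-- The mini-batch Hessian of a loss. -/
def batchHess (f : Vec d → Z → ℝ) (S : Fin K → Z) (w : Vec d) : Vec d →L[ℝ] Vec d :=
  (K : ℝ)⁻¹ • ∑ k, hess (fun w' => f w' (S k)) w

/-- The state of the algorithm: the meta-model `w`, the personalized models `uⁱ`, and the set of
the tasks that have been sampled so far. -/
structure State (d n : ℕ) where
  w : Vec d
  u : Fin n → Vec d
  seen : Finset (Fin n)

/-- The update of the personalized models. A sampled task makes the momentum step
`uⁱ ← (1 - β) uⁱ + β v̂ⁱ` with `v̂ⁱ = w - α ∇̂_{𝓢₁} 𝓛ᵢ(w)`, except that its personalized model is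
initialized as `uⁱ ← v̂ⁱ` when the task is sampled for the first time. The other tasks are left
untouched. -/
def updateU (α β : ℝ) (ℓ : Fin n → Vec d → Z → ℝ) (s : State d n) (b : TaskBatch n B)
    (S₁ : DataBatch n K Z) (i : Fin n) : Vec d :=
  if i ∈ b.1 then
    if i ∈ s.seen then
      (1 - β) • s.u i + β • (s.w - α • batchGrad (ℓ i) (S₁ i) s.w)
    else s.w - α • batchGrad (ℓ i) (S₁ i) s.w
  else s.u i

/-- The stochastic meta-gradient
`Δ̂ = (1/B) ∑_{i ∈ 𝓑} (I - α ∇̂²_{𝓢₂} 𝓛ᵢ(w)) ∇̂_{𝓢₃} 𝓛ᵢ(uⁱ)`, where `u` are the updated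
personalized models. -/
def metaGrad (α : ℝ) (ℓ : Fin n → Vec d → Z → ℝ) (w : Vec d) (u : Fin n → Vec d)
    (b : TaskBatch n B) (S₂ S₃ : DataBatch n K Z) : Vec d :=
  (B : ℝ)⁻¹ • ∑ i ∈ b.1,
    (ContinuousLinearMap.id ℝ (Vec d) - α • batchHess (ℓ i) (S₂ i) w)
      (batchGrad (ℓ i) (S₃ i) (u i))

/-- One iteration. -/
def step (α η β : ℝ) (ℓ : Fin n → Vec d → Z → ℝ) (s : State d n) (x : StepSample n B K Z) :
    State d n where
  w := s.w - η • metaGrad α ℓ s.w (updateU α β ℓ s x.1 x.2.1) x.1 x.2.2.1 x.2.2.2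
  u := updateU α β ℓ s x.1 x.2.1
  seen := s.seen ∪ x.1.1

/-- The state before iteration `t`, when the algorithm starts from `w₀` and the randomness of the
iterations is `x`. The initial value `0` of the personalized models is never read. -/
def run (α η β : ℝ) (ℓ : Fin n → Vec d → Z → ℝ) (w₀ : Vec d) (x : ℕ → StepSample n B K Z) :
    ℕ → State d n
  | 0 => ⟨w₀, 0, ∅⟩
  | t + 1 => step α η β ℓ (run α η β ℓ w₀ x t) (x t)

/-- The step size `η = B^{2/5} / (n^{2/5} T^{3/5})`. -/
def stepSize (B n T : ℕ) : ℝ :=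
  (B : ℝ) ^ (2 / 5 : ℝ) / ((n : ℝ) ^ (2 / 5 : ℝ) * (T : ℝ) ^ (3 / 5 : ℝ))

/-- The momentum factor `β = n^{2/5} / (B^{2/5} T^{2/5})`. -/
def momentum (B n T : ℕ) : ℝ :=
  (n : ℝ) ^ (2 / 5 : ℝ) / ((B : ℝ) ^ (2 / 5 : ℝ) * (T : ℝ) ^ (2 / 5 : ℝ))

end Algorithm

end MOML

end

/-!
The Lyapunov function is the optimality gap of the meta-model plus `r κ` times the mean squared
distance of the personalized models `uⁱ` to the adapted models `w - α ∇ℒᵢ(w)`, where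
`r = (n / (B T))^{1/5}`, `β = r²` and `η = r³ B / n`. That distance is all that biases the
stochastic meta-gradient: a sampled task contracts it by the factor `1 - β` up to noise `β² α² σG²`,
and moving the meta-model by `w' - w` perturbs it by `(1 + α L) ‖w' - w‖ = O(η)`. A task that has
not been sampled yet is charged a constant distance, so that its initialization fits the same
recursion. By Young's inequality one iteration then decreases the Lyapunov function in expectation
by `(η / 2) ‖∇F(w)‖²` up to noise of order `η r²`. Summing over the `T` iterations, and using
`1 / (η T) = r²`, bounds the mean of `‖∇F‖²` by a multiple of `r²`, which is at most `ε²` as soon as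
`T ≥ C n / (B ε⁵)`.
-/

noncomputable section

namespace MOML

section Calculus

variable {E : Type*} [NormedAddCommGroup E] [InnerProductSpace ℝ E] [CompleteSpace E]
  {f : E → ℝ} {α L ρ G : ℝ}

/-- The model obtained from `w` by one gradient step of length `α` on the loss `f`. -/
def adapted (α : ℝ) (f : E → ℝ) (w : E) : E := w - α • ∇ f w

/-- The gradient of the adapted loss `w ↦ f (adapted α f w)`, by the chain rule. -/
def adaptedGrad (α : ℝ) (f : E → ℝ) (w : E) : E :=
  (ContinuousLinearMap.id ℝ E - α • fderiv ℝ (∇ f) w) (∇ f (adapted α f w))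

/-- A Lipschitz constant for the gradient of an adapted loss, hence also for that of the
meta-objective. -/
def adaptedSmoothness (α L ρ G : ℝ) : ℝ := (1 + α * L) ^ 2 * L + α * ρ * G

theorem adaptedSmoothness_nonneg (hα : 0 ≤ α) (hL : 0 ≤ L) (hρ : 0 ≤ ρ) (hG : 0 ≤ G) :
    0 ≤ adaptedSmoothness α L ρ G := by
  unfold adaptedSmoothness; positivity

theorem contDiff_gradient (hf : ContDiff ℝ 2 f) : ContDiff ℝ 1 (∇ f) :=
  (InnerProductSpace.toDual ℝ E).symm.contDiff.comp (hf.fderiv_right (by norm_num))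

theorem hasFDerivAt_gradient (hf : ContDiff ℝ 2 f) (w : E) :
    HasFDerivAt (∇ f) (fderiv ℝ (∇ f) w) w :=
  ((contDiff_gradient hf).differentiable (by norm_num) w).hasFDerivAt

theorem inner_fderiv_gradient (hf : ContDiff ℝ 2 f) (w x y : E) :
    inner ℝ (fderiv ℝ (∇ f) w x) y = fderiv ℝ (fderiv ℝ f) w x y := by
  have hderiv : HasFDerivAt (fderiv ℝ f) (fderiv ℝ (fderiv ℝ f) w) w :=
    ((hf.fderiv_right (m := 1) (by norm_num)).differentiable (by norm_num) w).hasFDerivAt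
  have hgrad : fderiv ℝ (∇ f) w = _ :=
    ((InnerProductSpace.toDual ℝ E).symm.toContinuousLinearEquiv.hasFDerivAt.comp w hderiv).fderiv
  rw [hgrad]
  exact InnerProductSpace.toDual_symm_apply

theorem fderiv_gradient_symmetric (hf : ContDiff ℝ 2 f) (w x y : E) :
    inner ℝ (fderiv ℝ (∇ f) w x) y = inner ℝ x (fderiv ℝ (∇ f) w y) := by
  rw [real_inner_comm _ x, inner_fderiv_gradient hf, inner_fderiv_gradient hf]
  exact (hf.contDiffAt.isSymmSndFDerivAt (by simp)) x y

theorem norm_fderiv_gradient_le (hL : 0 ≤ L)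
    (hgrad : ∀ w w', ‖∇ f w - ∇ f w'‖ ≤ L * ‖w - w'‖) (w : E) : ‖fderiv ℝ (∇ f) w‖ ≤ L :=
  norm_fderiv_le_of_lipschitz ℝ (C := ⟨L, hL⟩)
    (LipschitzWith.of_dist_le_mul fun x y => by
      rw [dist_eq_norm, dist_eq_norm]; exact hgrad x y)

theorem norm_id_sub_smul_fderiv_gradient_le (hα : 0 ≤ α) (hL : 0 ≤ L)
    (hgrad : ∀ w w', ‖∇ f w - ∇ f w'‖ ≤ L * ‖w - w'‖) (w : E) :
    ‖ContinuousLinearMap.id ℝ E - α • fderiv ℝ (∇ f) w‖ ≤ 1 + α * L := by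
  refine (norm_sub_le _ _).trans (add_le_add ContinuousLinearMap.norm_id_le ?_)
  rw [norm_smul, Real.norm_of_nonneg hα]
  exact mul_le_mul_of_nonneg_left (norm_fderiv_gradient_le hL hgrad w) hα

theorem norm_adapted_sub_le (hα : 0 ≤ α)
    (hgrad : ∀ w w', ‖∇ f w - ∇ f w'‖ ≤ L * ‖w - w'‖) (w w' : E) :
    ‖adapted α f w - adapted α f w'‖ ≤ (1 + α * L) * ‖w - w'‖ :=
  calc ‖adapted α f w - adapted α f w'‖ = ‖(w - w') - α • (∇ f w - ∇ f w')‖ := by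
        simp only [adapted, smul_sub]; abel_nf
    _ ≤ ‖w - w'‖ + α * ‖∇ f w - ∇ f w'‖ := by
        simpa only [norm_smul, Real.norm_of_nonneg hα] using norm_sub_le (w - w') (α • _)
    _ ≤ ‖w - w'‖ + α * (L * ‖w - w'‖) := by gcongr; exact hgrad w w'
    _ = (1 + α * L) * ‖w - w'‖ := by ring

theorem hasGradientAt_comp_adapted (hf : ContDiff ℝ 2 f) (w : E) :
    HasGradientAt (fun w' => f (adapted α f w')) (adaptedGrad α f w) w := by
  have hadapted : HasFDerivAt (adapted α f)
      (ContinuousLinearMap.id ℝ E - α • fderiv ℝ (∇ f) w) w :=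
    (hasFDerivAt_id w).sub ((hasFDerivAt_gradient hf w).const_smul α)
  have hloss : HasFDerivAt f (fderiv ℝ f (adapted α f w)) (adapted α f w) :=
    (hf.differentiable (by norm_num) _).hasFDerivAt
  refine hasGradientAt_iff_hasFDerivAt.mpr
    ((hloss.comp w hadapted).congr_fderiv (ContinuousLinearMap.ext fun x => ?_))
  rw [InnerProductSpace.toDual_apply_apply, ContinuousLinearMap.comp_apply,
    ← inner_gradient_left (𝕜 := ℝ)]
  simp only [adaptedGrad, sub_apply, smul_apply, ContinuousLinearMap.id_apply, inner_sub_left,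
    inner_sub_right, real_inner_smul_left, real_inner_smul_right, fderiv_gradient_symmetric hf]

theorem continuous_adapted (hf : ContDiff ℝ 2 f) : Continuous (adapted α f) :=
  continuous_id.sub ((contDiff_gradient hf).continuous.const_smul α)

theorem continuous_adaptedGrad (hf : ContDiff ℝ 2 f) : Continuous (adaptedGrad α f) :=
  (continuous_const.sub (((contDiff_gradient hf).continuous_fderiv one_ne_zero).const_smul
    α)).clm_apply ((contDiff_gradient hf).continuous.comp (continuous_adapted hf))

theorem norm_adaptedGrad_sub_le (hα : 0 ≤ α) (hL : 0 ≤ L)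
    (hgrad : ∀ w w', ‖∇ f w - ∇ f w'‖ ≤ L * ‖w - w'‖)
    (hhess : ∀ w w', ‖fderiv ℝ (∇ f) w - fderiv ℝ (∇ f) w'‖ ≤ ρ * ‖w - w'‖)
    (hbdd : ∀ w, ‖∇ f w‖ ≤ G) (w w' : E) :
    ‖adaptedGrad α f w - adaptedGrad α f w'‖
      ≤ adaptedSmoothness α L ρ G * ‖w - w'‖ := by
  set J := fun w => ContinuousLinearMap.id ℝ E - α • fderiv ℝ (∇ f) w
  have hJ : ‖J w - J w'‖ ≤ α * (ρ * ‖w - w'‖) := by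
    have : J w - J w' = -(α • (fderiv ℝ (∇ f) w - fderiv ℝ (∇ f) w')) := by
      simp only [J, smul_sub]; abel
    rw [this, norm_neg, norm_smul, Real.norm_of_nonneg hα]
    exact mul_le_mul_of_nonneg_left (hhess w w') hα
  have hsplit : adaptedGrad α f w - adaptedGrad α f w' =
      J w (∇ f (adapted α f w) - ∇ f (adapted α f w'))
        + (J w - J w') (∇ f (adapted α f w')) := by
    simp only [adaptedGrad, J, map_sub, sub_apply]; abel
  have hfirst : ‖J w (∇ f (adapted α f w) - ∇ f (adapted α f w'))‖
      ≤ (1 + α * L) * (L * ((1 + α * L) * ‖w - w'‖)) :=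
    (ContinuousLinearMap.le_of_opNorm_le _
      (norm_id_sub_smul_fderiv_gradient_le hα hL hgrad w) _).trans <| by
      gcongr
      exact (hgrad _ _).trans (by gcongr; exact norm_adapted_sub_le hα hgrad w w')
  have hsecond : ‖(J w - J w') (∇ f (adapted α f w'))‖ ≤ α * (ρ * ‖w - w'‖) * G :=
    (ContinuousLinearMap.le_of_opNorm_le _ hJ _).trans
      (mul_le_mul_of_nonneg_left (hbdd _) ((norm_nonneg _).trans hJ))
  rw [hsplit]
  refine (norm_add_le _ _).trans ((add_le_add hfirst hsecond).trans_eq ?_)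
  rw [adaptedSmoothness]; ring

/-- The square of a Lipschitz constant for the dependence of the gradient of an adapted loss on the
adapted model at which the loss is evaluated. -/
def biasConst (α L : ℝ) : ℝ := ((1 + α * L) * L) ^ 2

theorem biasConst_nonneg : 0 ≤ biasConst α L := sq_nonneg _

theorem le_inner_id_sub_smul_fderiv_gradient_apply (hα : 0 ≤ α) (hL : 0 ≤ L)
    (hgrad : ∀ w w', ‖∇ f w - ∇ f w'‖ ≤ L * ‖w - w'‖) (w u a : E) :
    inner ℝ a (adaptedGrad α f w) - ‖a‖ ^ 2 / 2 - biasConst α L / 2 * ‖u - adapted α f w‖ ^ 2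
      ≤ inner ℝ a ((ContinuousLinearMap.id ℝ E - α • fderiv ℝ (∇ f) w) (∇ f u)) := by
  set b := (ContinuousLinearMap.id ℝ E - α • fderiv ℝ (∇ f) w) (∇ f u) - adaptedGrad α f w with hb
  have hbias : ‖b‖ ^ 2 ≤ biasConst α L * ‖u - adapted α f w‖ ^ 2 := by
    rw [biasConst, ← mul_pow, hb, adaptedGrad, ← map_sub, mul_assoc]
    refine pow_le_pow_left₀ (norm_nonneg _) ((ContinuousLinearMap.le_of_opNorm_le _
      (norm_id_sub_smul_fderiv_gradient_le hα hL hgrad w) _).trans ?_) 2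
    gcongr
    exact hgrad _ _
  have hinner := neg_le_of_abs_le (abs_real_inner_le_norm a b)
  have hyoung := two_mul_le_add_sq ‖a‖ ‖b‖
  rw [hb, inner_sub_right] at hinner
  linarith

-- The mean value theorem loses a factor `2` on the quadratic term.
theorem le_add_inner_add_of_lipschitz_gradient {g : E → E} (hL : 0 ≤ L)
    (hf : ∀ w, HasGradientAt f (g w) w) (hg : ∀ w w', ‖g w - g w'‖ ≤ L * ‖w - w'‖) (w w' : E) :
    f w' ≤ f w + inner ℝ (g w) (w' - w) + L * ‖w' - w‖ ^ 2 := by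
  obtain ⟨z, hz, hmvt⟩ := domain_mvt (s := Set.univ) (x := w) (y := w')
    (fun x _ => (hf x).hasFDerivAt.hasFDerivWithinAt) convex_univ trivial trivial
  rw [InnerProductSpace.toDual_apply_apply] at hmvt
  have hinner : inner ℝ (g z - g w) (w' - w) ≤ L * ‖w' - w‖ * ‖w' - w‖ :=
    (real_inner_le_norm _ _).trans (mul_le_mul_of_nonneg_right
      ((hg z w).trans (mul_le_mul_of_nonneg_left (norm_sub_le_of_mem_segment hz) hL))
      (norm_nonneg _))
  rw [inner_sub_left] at hinner
  linarith [sq ‖w' - w‖]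

end Calculus

section Objective

variable {d n : ℕ} {Z : Type*} [MeasurableSpace Z] {α L ρ G σG σH : ℝ}
  {ℓ : Fin n → Vec d → Z → ℝ} {D : Fin n → Measure Z}

theorem Assumptions.hasGradientAt_metaObjective (h : Assumptions α L ρ G σG σH ℓ D) (w : Vec d) :
    HasGradientAt (metaObjective α ℓ D) ((n : ℝ)⁻¹ • ∑ i, adaptedGrad α (risk ℓ D i) w) w := by
  rw [hasGradientAt_iff_hasFDerivAt, map_smul, map_sum]
  exact (HasFDerivAt.fun_sum fun i _ =>
    (hasGradientAt_comp_adapted (h.risk_contDiff i) w).hasFDerivAt).const_mul (n : ℝ)⁻¹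

theorem Assumptions.gradient_metaObjective (h : Assumptions α L ρ G σG σH ℓ D) :
    ∇ (metaObjective α ℓ D) = fun w => (n : ℝ)⁻¹ • ∑ i, adaptedGrad α (risk ℓ D i) w :=
  gradient_eq h.hasGradientAt_metaObjective

theorem Assumptions.continuous_metaObjective (h : Assumptions α L ρ G σG σH ℓ D) :
    Continuous (metaObjective α ℓ D) :=
  continuous_iff_continuousAt.mpr fun w => (h.hasGradientAt_metaObjective w).continuousAt

theorem Assumptions.continuous_gradient_metaObjective (h : Assumptions α L ρ G σG σH ℓ D) :
    Continuous (∇ (metaObjective α ℓ D)) := by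
  rw [h.gradient_metaObjective]
  have hsum : Continuous fun w => ∑ i, adaptedGrad α (risk ℓ D i) w :=
    continuous_finsetSum _ fun i _ => continuous_adaptedGrad (h.risk_contDiff i)
  exact hsum.const_smul (n : ℝ)⁻¹

theorem Assumptions.norm_gradient_metaObjective_sub_le (h : Assumptions α L ρ G σG σH ℓ D)
    (hn : 0 < n) (hα : 0 ≤ α) (hL : 0 ≤ L) (w w' : Vec d) :
    ‖∇ (metaObjective α ℓ D) w - ∇ (metaObjective α ℓ D) w'‖
      ≤ adaptedSmoothness α L ρ G * ‖w - w'‖ := by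
  have hn' : (0 : ℝ) < n := Nat.cast_pos.mpr hn
  simp only [h.gradient_metaObjective]
  rw [← smul_sub, ← Finset.sum_sub_distrib, norm_smul, norm_inv, Real.norm_of_nonneg hn'.le,
    inv_mul_le_iff₀ hn']
  refine (norm_sum_le_of_le _ fun i _ => norm_adaptedGrad_sub_le hα hL (h.grad_lipschitz i)
    (h.hess_lipschitz i) (h.grad_bounded i) w w').trans_eq ?_
  simp

theorem Assumptions.metaObjective_descent (h : Assumptions α L ρ G σG σH ℓ D)
    (hn : 0 < n) (hα : 0 ≤ α) (hL : 0 ≤ L) (hρ : 0 ≤ ρ) (hG : 0 ≤ G) (w w' : Vec d) :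
    metaObjective α ℓ D w' ≤ metaObjective α ℓ D w
      + inner ℝ (∇ (metaObjective α ℓ D) w) (w' - w)
      + adaptedSmoothness α L ρ G * ‖w' - w‖ ^ 2 :=
  le_add_inner_add_of_lipschitz_gradient (adaptedSmoothness_nonneg hα hL hρ hG)
    (fun w => (h.hasGradientAt_metaObjective w).differentiableAt.hasGradientAt)
    (h.norm_gradient_metaObjective_sub_le hn hα hL) w w'

end Objective

section Moments

theorem integrable_prod_of_forall_integral_le {X Y : Type*} [MeasurableSpace X]
    [MeasurableSpace Y] {μ : Measure X} {ν : Measure Y} [IsProbabilityMeasure μ] [SFinite ν]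
    {f : X × Y → ℝ} {M : ℝ} (hf : AEStronglyMeasurable f (μ.prod ν)) (hf₀ : ∀ p, 0 ≤ f p)
    (hint : ∀ x, Integrable (fun y => f (x, y)) ν) (hM : ∀ x, ∫ y, f (x, y) ∂ν ≤ M) :
    Integrable f (μ.prod ν) ∧ ∫ p, f p ∂(μ.prod ν) ≤ M := by
  have hinner : Integrable (fun x => ∫ y, ‖f (x, y)‖ ∂ν) μ := by
    refine .of_bound hf.norm.integral_prod_right' M (.of_forall fun x => ?_)
    rw [Real.norm_of_nonneg (integral_nonneg fun y => norm_nonneg _)]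
    simpa only [Real.norm_of_nonneg (hf₀ _)] using hM x
  have hfint : Integrable f (μ.prod ν) :=
    (integrable_prod_iff hf).mpr ⟨.of_forall hint, hinner⟩
  refine ⟨hfint, ?_⟩
  rw [integral_prod _ hfint]
  simpa using integral_mono hfint.integral_prod_left (integrable_const M) hM

theorem norm_inv_card_smul_sum_sq_le {ι E : Type*} [SeminormedAddCommGroup E] [NormedSpace ℝ E]
    (s : Finset ι) (x : ι → E) :
    ‖(s.card : ℝ)⁻¹ • ∑ i ∈ s, x i‖ ^ 2 ≤ (s.card : ℝ)⁻¹ * ∑ i ∈ s, ‖x i‖ ^ 2 := by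
  rcases s.eq_empty_or_nonempty with rfl | hs
  · simp
  calc ‖(s.card : ℝ)⁻¹ • ∑ i ∈ s, x i‖ ^ 2
      = ((s.card : ℝ)⁻¹) ^ 2 * ‖∑ i ∈ s, x i‖ ^ 2 := by
        rw [norm_smul, mul_pow, Real.norm_of_nonneg (by positivity)]
    _ ≤ ((s.card : ℝ)⁻¹) ^ 2 * (∑ i ∈ s, ‖x i‖) ^ 2 := by gcongr; exact norm_sum_le _ _
    _ ≤ ((s.card : ℝ)⁻¹) ^ 2 * (s.card * ∑ i ∈ s, ‖x i‖ ^ 2) := by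
        gcongr; exact sq_sum_le_card_mul_sum_sq
    _ = (s.card : ℝ)⁻¹ * ∑ i ∈ s, ‖x i‖ ^ 2 := by field_simp

theorem memLp_two_clm_apply_prod {Ω₁ Ω₂ E F : Type*} [MeasurableSpace Ω₁] [MeasurableSpace Ω₂]
    [NormedAddCommGroup E] [NormedSpace ℝ E] [NormedAddCommGroup F] [NormedSpace ℝ F]
    {μ : Measure Ω₁} {ν : Measure Ω₂} [SFinite μ] [SFinite ν] {J : Ω₁ → E →L[ℝ] F} {g : Ω₂ → E}
    (hJ : MemLp J 2 μ) (hg : MemLp g 2 ν) :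
    MemLp (fun p : Ω₁ × Ω₂ => J p.1 (g p.2)) 2 (μ.prod ν) ∧
      ∫ p, ‖J p.1 (g p.2)‖ ^ 2 ∂(μ.prod ν) ≤ (∫ ω, ‖J ω‖ ^ 2 ∂μ) * ∫ ω, ‖g ω‖ ^ 2 ∂ν := by
  have hmeas : AEStronglyMeasurable (fun p : Ω₁ × Ω₂ => J p.1 (g p.2)) (μ.prod ν) :=
    isBoundedBilinearMap_apply.continuous.comp_aestronglyMeasurable
      (hJ.aestronglyMeasurable.comp_fst.prodMk hg.aestronglyMeasurable.comp_snd)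
  have hprod : Integrable (fun p : Ω₁ × Ω₂ => ‖J p.1‖ ^ 2 * ‖g p.2‖ ^ 2) (μ.prod ν) :=
    (hJ.integrable_norm_pow two_ne_zero).mul_prod (hg.integrable_norm_pow two_ne_zero)
  have hle : ∀ p : Ω₁ × Ω₂, ‖J p.1 (g p.2)‖ ^ 2 ≤ ‖J p.1‖ ^ 2 * ‖g p.2‖ ^ 2 := fun p => by
    rw [← mul_pow]
    exact pow_le_pow_left₀ (norm_nonneg _) ((J p.1).le_opNorm _) 2
  have hint : Integrable (fun p : Ω₁ × Ω₂ => ‖J p.1 (g p.2)‖ ^ 2) (μ.prod ν) :=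
    hprod.mono' (hmeas.norm.pow 2) (.of_forall fun p => by
      rw [Real.norm_of_nonneg (by positivity)]; exact hle p)
  refine ⟨(memLp_two_iff_integrable_sq_norm hmeas).mpr hint, ?_⟩
  rw [← integral_prod_mul (fun ω => ‖J ω‖ ^ 2) fun ω => ‖g ω‖ ^ 2]
  exact integral_mono hint hprod hle

/-- The square integrable random vector `X` is an unbiased estimator of `m` with variance at most
`v`. -/
structure IsUnbiasedEstimator {Ω E : Type*} [MeasurableSpace Ω] [NormedAddCommGroup E]
    [NormedSpace ℝ E] (X : Ω → E) (m : E) (v : ℝ) (μ : Measure Ω) : Prop where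
  memLp : MemLp X 2 μ
  integral_eq : ∫ ω, X ω ∂μ = m
  variance_le : ∫ ω, ‖X ω - m‖ ^ 2 ∂μ ≤ v

namespace IsUnbiasedEstimator

variable {Ω Ω' E : Type*} [MeasurableSpace Ω] [MeasurableSpace Ω'] [NormedAddCommGroup E]
  [NormedSpace ℝ E] {μ : Measure Ω} {ν : Measure Ω'} {X : Ω → E} {m : E} {v : ℝ}

theorem of_integrable_norm_sub_sq [IsFiniteMeasure μ] (hX : AEStronglyMeasurable X μ)
    (hm : ∫ ω, X ω ∂μ = m) (hint : Integrable (fun ω => ‖X ω - m‖ ^ 2) μ)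
    (hv : ∫ ω, ‖X ω - m‖ ^ 2 ∂μ ≤ v) : IsUnbiasedEstimator X m v μ where
  memLp := by
    simpa using ((memLp_two_iff_integrable_sq_norm
      (hX.sub aestronglyMeasurable_const)).mpr hint).add (memLp_const m)
  integral_eq := hm
  variance_le := hv

theorem comp_measurePreserving (hX : IsUnbiasedEstimator X m v μ) {g : Ω' → Ω}
    (hg : MeasurePreserving g ν μ) : IsUnbiasedEstimator (fun ω => X (g ω)) m v ν where
  memLp := hX.memLp.comp_measurePreserving hg
  integral_eq := by
    have hXm : AEStronglyMeasurable X (ν.map g) := by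
      rw [hg.map_eq]; exact hX.memLp.aestronglyMeasurable
    rw [← integral_map hg.aemeasurable hXm, hg.map_eq, hX.integral_eq]
  variance_le := by
    have hXm : AEStronglyMeasurable (fun ω => ‖X ω - m‖ ^ 2) (ν.map g) := by
      rw [hg.map_eq]
      exact (hX.memLp.aestronglyMeasurable.sub aestronglyMeasurable_const).norm.pow 2
    rw [← integral_map hg.aemeasurable hXm, hg.map_eq]
    exact hX.variance_le

variable [IsProbabilityMeasure μ]

theorem integrable (hX : IsUnbiasedEstimator X m v μ) : Integrable X μ :=
  hX.memLp.integrable one_le_two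

theorem integrable_norm_sub_sq (hX : IsUnbiasedEstimator X m v μ) :
    Integrable (fun ω => ‖X ω - m‖ ^ 2) μ :=
  (hX.memLp.sub (memLp_const m)).integrable_norm_pow two_ne_zero

theorem const_sub_smul [CompleteSpace E] (hX : IsUnbiasedEstimator X m v μ) (a : E) (c : ℝ) :
    IsUnbiasedEstimator (fun ω => a - c • X ω) (a - c • m) (c ^ 2 * v) μ where
  memLp := (memLp_const a).sub (hX.memLp.const_smul c)
  integral_eq := by
    rw [integral_sub (integrable_const a) (hX.integrable.fun_smul c), integral_smul, hX.integral_eq]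
    simp
  variance_le := by
    have hdev : ∀ ω, ‖a - c • X ω - (a - c • m)‖ ^ 2 = c ^ 2 * ‖X ω - m‖ ^ 2 := fun ω => by
      rw [sub_sub_sub_cancel_left, ← smul_sub, norm_smul, mul_pow, norm_sub_rev, Real.norm_eq_abs,
        sq_abs]
    simp only [hdev, integral_const_mul]
    exact mul_le_mul_of_nonneg_left hX.variance_le (sq_nonneg c)

theorem average {ι : Type*} {s : Finset ι} (hs : s.Nonempty) {X : ι → Ω → E}
    (hX : ∀ i, IsUnbiasedEstimator (X i) m v μ) :
    IsUnbiasedEstimator (fun ω => (s.card : ℝ)⁻¹ • ∑ i ∈ s, X i ω) m v μ where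
  memLp := (memLp_finsetSum s fun i _ => (hX i).memLp).const_smul _
  integral_eq := by
    have hcard : (s.card : ℝ) ≠ 0 := by exact_mod_cast hs.card_ne_zero
    rw [integral_smul, integral_finsetSum s fun i _ => (hX i).integrable]
    simp only [(hX _).integral_eq, Finset.sum_const, ← Nat.cast_smul_eq_nsmul ℝ,
      inv_smul_smul₀ hcard]
  variance_le := by
    have hcard : (0 : ℝ) < s.card := by exact_mod_cast hs.card_pos
    have hdev : ∀ ω, ‖(s.card : ℝ)⁻¹ • ∑ i ∈ s, X i ω - m‖ ^ 2
        ≤ (s.card : ℝ)⁻¹ * ∑ i ∈ s, ‖X i ω - m‖ ^ 2 := fun ω => by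
      refine le_of_eq_of_le ?_ (norm_inv_card_smul_sum_sq_le s fun i => X i ω - m)
      rw [Finset.sum_sub_distrib, Finset.sum_const, ← Nat.cast_smul_eq_nsmul ℝ, smul_sub,
        inv_smul_smul₀ hcard.ne']
    have hint : Integrable (fun ω => (s.card : ℝ)⁻¹ * ∑ i ∈ s, ‖X i ω - m‖ ^ 2) μ :=
      (integrable_finsetSum s fun i _ => (hX i).integrable_norm_sub_sq).const_mul _
    refine (integral_mono_of_nonneg (.of_forall fun ω => by positivity) hint
      (.of_forall hdev)).trans ?_
    rw [integral_const_mul, integral_finsetSum s fun i _ => (hX i).integrable_norm_sub_sq,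
      inv_mul_le_iff₀ hcard, ← nsmul_eq_mul]
    exact Finset.sum_le_card_nsmul s _ v fun i _ => (hX i).variance_le

theorem sampleMean (hX : IsUnbiasedEstimator X m v μ) {K : ℕ} (hK : 0 < K) :
    IsUnbiasedEstimator (fun S : Fin K → Ω => (K : ℝ)⁻¹ • ∑ k, X (S k)) m v
      (Measure.pi fun _ => μ) := by
  have hne : (Finset.univ : Finset (Fin K)).Nonempty := ⟨⟨0, hK⟩, Finset.mem_univ _⟩
  simpa using average hne fun k =>
    hX.comp_measurePreserving (measurePreserving_eval (fun _ : Fin K => μ) k)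

theorem integral_norm_sq_le (hX : IsUnbiasedEstimator X m v μ) {a : ℝ} (hm : ‖m‖ ≤ a) :
    ∫ ω, ‖X ω‖ ^ 2 ∂μ ≤ 2 * (a ^ 2 + v) := by
  have hle : ∀ ω, ‖X ω‖ ^ 2 ≤ 2 * ‖X ω - m‖ ^ 2 + 2 * a ^ 2 := fun ω => by
    have htri : ‖X ω‖ ≤ ‖X ω - m‖ + a := by linarith [norm_sub_norm_le (X ω) m]
    nlinarith [norm_nonneg (X ω), sq_nonneg (‖X ω - m‖ - a)]
  refine (integral_mono (hX.memLp.integrable_norm_pow two_ne_zero)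
    ((hX.integrable_norm_sub_sq.const_mul 2).fun_add (integrable_const _)) hle).trans ?_
  rw [integral_add (hX.integrable_norm_sub_sq.const_mul 2) (integrable_const _),
    integral_const_mul]
  simp only [integral_const, probReal_univ, one_smul]
  linarith [hX.variance_le]

end IsUnbiasedEstimator

theorem IsUnbiasedEstimator.integral_norm_add_smul_sub_sq_le {Ω E : Type*} [MeasurableSpace Ω]
    [NormedAddCommGroup E] [InnerProductSpace ℝ E] [CompleteSpace E] {μ : Measure Ω}
    [IsProbabilityMeasure μ] {X : Ω → E} {m : E} {v : ℝ} (hX : IsUnbiasedEstimator X m v μ)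
    (a : E) (c : ℝ) :
    ∫ ω, ‖a + c • (X ω - m)‖ ^ 2 ∂μ ≤ ‖a‖ ^ 2 + c ^ 2 * v := by
  have hdev : Integrable (fun ω => X ω - m) μ := hX.integrable.sub (integrable_const m)
  have hcentered : ∫ ω, inner ℝ a (X ω - m) ∂μ = 0 := by
    rw [integral_inner hdev, integral_sub hX.integrable (integrable_const m), hX.integral_eq]
    simp
  have hexpand : ∀ ω, ‖a + c • (X ω - m)‖ ^ 2 =
      ‖a‖ ^ 2 + ((2 * c) * inner ℝ a (X ω - m) + c ^ 2 * ‖X ω - m‖ ^ 2) := fun ω => by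
    rw [norm_add_sq_real, real_inner_smul_right, norm_smul, mul_pow, Real.norm_eq_abs, sq_abs]
    ring
  have hlin : Integrable (fun ω => (2 * c) * inner ℝ a (X ω - m)) μ :=
    (hdev.const_inner a).const_mul _
  have hquad : Integrable (fun ω => c ^ 2 * ‖X ω - m‖ ^ 2) μ :=
    hX.integrable_norm_sub_sq.const_mul _
  simp only [hexpand]
  rw [integral_add (integrable_const _) (hlin.fun_add hquad), integral_add hlin hquad,
    integral_const_mul, integral_const_mul, hcentered]
  simpa using mul_le_mul_of_nonneg_left hX.variance_le (sq_nonneg c)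

end Moments

section SingleTask

/-- The data that one iteration draws for one task: its three batches of `K` points. -/
abbrev TaskSample (K : ℕ) (Z : Type*) := (Fin K → Z) × (Fin K → Z) × (Fin K → Z)

/-- The law of `K` independent points distributed as `μ`. -/
abbrev pointsLaw (K : ℕ) {Z : Type*} [MeasurableSpace Z] (μ : Measure Z) : Measure (Fin K → Z) :=
  Measure.pi fun _ => μ

/-- The law of three independent batches of `K` independent points distributed as `μ`. -/
abbrev taskLaw (K : ℕ) {Z : Type*} [MeasurableSpace Z] (μ : Measure Z) :
    Measure (TaskSample K Z) :=
  (pointsLaw K μ).prod ((pointsLaw K μ).prod (pointsLaw K μ))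

variable {d n K : ℕ} {Z : Type*} {α β L ρ G σG σH : ℝ} {ℓ : Fin n → Vec d → Z → ℝ}

/-- The personalized model of task `i` after an iteration in which the task is sampled, with the
data `S` as its first batch. -/
def sampledModel (α β : ℝ) (ℓ : Fin n → Vec d → Z → ℝ) (s : State d n) (i : Fin n)
    (S : Fin K → Z) : Vec d :=
  if i ∈ s.seen then (1 - β) • s.u i + β • (s.w - α • batchGrad (ℓ i) S s.w)
  else s.w - α • batchGrad (ℓ i) S s.w

/-- The contribution of the sampled task `i`, with the data `S`, to the stochastic
meta-gradient. -/
def taskGrad (α β : ℝ) (ℓ : Fin n → Vec d → Z → ℝ) (s : State d n) (i : Fin n)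
    (S : TaskSample K Z) : Vec d :=
  (ContinuousLinearMap.id ℝ (Vec d) - α • batchHess (ℓ i) S.2.1 s.w)
    (batchGrad (ℓ i) S.2.2 (sampledModel α β ℓ s i S.1))

variable [MeasurableSpace Z] {D : Fin n → Measure Z}

/-- The squared distance of the personalized model of task `i` to its target, the adapted model.
For a task that has not been sampled yet it is a constant, chosen so large that the recursion of
`Assumptions.integral_sampledModel_sub_sq_le` also holds for the initialization step. -/
def taskError (α σG : ℝ) (ℓ : Fin n → Vec d → Z → ℝ) (D : Fin n → Measure Z) (s : State d n)
    (i : Fin n) : ℝ :=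
  if i ∈ s.seen then ‖s.u i - adapted α (risk ℓ D i) s.w‖ ^ 2 else 2 * (α ^ 2 * σG ^ 2)

theorem taskError_nonneg (s : State d n) (i : Fin n) : 0 ≤ taskError α σG ℓ D s i := by
  unfold taskError
  split_ifs <;> positivity

theorem Assumptions.measurable_batchGrad (h : Assumptions α L ρ G σG σH ℓ D) (i : Fin n)
    {Y : Type*} [MeasurableSpace Y] {S : Y → Fin K → Z} {w : Y → Vec d} (hS : Measurable S)
    (hw : Measurable w) : Measurable fun y => batchGrad (ℓ i) (S y) (w y) := by
  have hsum : Measurable fun y => ∑ k, ∇ (fun w' => ℓ i w' (S y k)) (w y) :=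
    Finset.measurable_fun_sum _ fun k _ => (h.grad_measurable i).comp
      (hw.prodMk ((measurable_pi_apply k).comp hS))
  exact hsum.const_smul (K : ℝ)⁻¹

theorem Assumptions.measurable_batchHess (h : Assumptions α L ρ G σG σH ℓ D) (i : Fin n)
    {Y : Type*} [MeasurableSpace Y] {S : Y → Fin K → Z} {w : Y → Vec d} (hS : Measurable S)
    (hw : Measurable w) : Measurable fun y => batchHess (ℓ i) (S y) (w y) := by
  have hsum : Measurable fun y => ∑ k, hess (fun w' => ℓ i w' (S y k)) (w y) :=
    Finset.measurable_fun_sum _ fun k _ => (h.hess_measurable i).comp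
      (hw.prodMk ((measurable_pi_apply k).comp hS))
  exact hsum.const_smul (K : ℝ)⁻¹

instance : MeasurableSpace (State d n) :=
  MeasurableSpace.comap (fun s => (s.w, s.u, fun i => i ∈ s.seen))
    (inferInstance : MeasurableSpace (Vec d × (Fin n → Vec d) × (Fin n → Prop)))

theorem measurable_state_iff {Y : Type*} [MeasurableSpace Y] {f : Y → State d n} :
    Measurable f ↔ (Measurable fun y => (f y).w) ∧ (∀ i, Measurable fun y => (f y).u i) ∧
      ∀ i, MeasurableSet {y | i ∈ (f y).seen} := by
  rw [measurable_comap_iff]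
  refine ⟨fun h => ⟨h.fst, fun i => (measurable_pi_apply i).comp h.snd.fst, fun i =>
    measurableSet_setOfPred.mpr ((measurable_pi_apply i).comp h.snd.snd)⟩, fun h =>
    h.1.prodMk ((measurable_pi_iff.mpr h.2.1).prodMk
      (measurable_pi_iff.mpr fun i => measurableSet_setOfPred.mp (h.2.2 i)))⟩

theorem measurable_state_w : Measurable (State.w : State d n → Vec d) :=
  (measurable_state_iff.mp measurable_id).1

theorem measurable_state_u (i : Fin n) : Measurable fun s : State d n => s.u i :=
  (measurable_state_iff.mp measurable_id).2.1 i

theorem measurableSet_mem_seen (i : Fin n) : MeasurableSet {s : State d n | i ∈ s.seen} :=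
  (measurable_state_iff.mp measurable_id).2.2 i

theorem Assumptions.measurable_sampledModel (h : Assumptions α L ρ G σG σH ℓ D) (i : Fin n)
    {Y : Type*} [MeasurableSpace Y] {s : Y → State d n} {S : Y → Fin K → Z} (hs : Measurable s)
    (hS : Measurable S) : Measurable fun y => sampledModel α β ℓ (s y) i (S y) := by
  have hw : Measurable fun y => (s y).w := measurable_state_w.comp hs
  have hu : Measurable fun y => (s y).u i := (measurable_state_u i).comp hs
  have hgrad := h.measurable_batchGrad i hS hw
  exact Measurable.ite (hs (measurableSet_mem_seen i)) (by fun_prop) (by fun_prop)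

theorem Assumptions.measurable_taskGrad (h : Assumptions α L ρ G σG σH ℓ D) (i : Fin n)
    {Y : Type*} [MeasurableSpace Y] {s : Y → State d n} {S : Y → TaskSample K Z}
    (hs : Measurable s) (hS : Measurable S) :
    Measurable fun y => taskGrad α β ℓ (s y) i (S y) :=
  ContinuousLinearMap.measurable_apply₂.comp
    ((((h.measurable_batchHess i hS.snd.fst (measurable_state_w.comp hs)).const_smul
        α).const_sub _).prodMk
      (h.measurable_batchGrad i hS.snd.snd (h.measurable_sampledModel i hs hS.fst)))

theorem Assumptions.measurable_taskError (h : Assumptions α L ρ G σG σH ℓ D) (i : Fin n) :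
    Measurable fun s => taskError α σG ℓ D s i :=
  Measurable.ite (measurableSet_mem_seen i) (((measurable_state_u i).sub
    ((continuous_adapted (h.risk_contDiff i)).measurable.comp measurable_state_w)).norm.pow_const 2)
    measurable_const

variable [∀ i, IsProbabilityMeasure (D i)]

theorem Assumptions.isUnbiasedEstimator_batchGrad (h : Assumptions α L ρ G σG σH ℓ D)
    (hK : 0 < K) (i : Fin n) (w : Vec d) :
    IsUnbiasedEstimator (fun S => batchGrad (ℓ i) S w) (∇ (risk ℓ D i) w) (σG ^ 2)
      (pointsLaw K (D i)) :=
  (IsUnbiasedEstimator.of_integrable_norm_sub_sq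
    ((h.grad_measurable i).comp measurable_prodMk_left).aestronglyMeasurable (h.grad_unbiased i w)
    (h.grad_sq_integrable i w) (h.grad_variance i w)).sampleMean hK

theorem Assumptions.isUnbiasedEstimator_batchHess (h : Assumptions α L ρ G σG σH ℓ D)
    (hK : 0 < K) (i : Fin n) (w : Vec d) :
    IsUnbiasedEstimator (fun S => batchHess (ℓ i) S w) (hess (risk ℓ D i) w) (σH ^ 2)
      (pointsLaw K (D i)) :=
  (IsUnbiasedEstimator.of_integrable_norm_sub_sq
    ((h.hess_measurable i).comp measurable_prodMk_left).aestronglyMeasurable (h.hess_unbiased i w)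
    (h.hess_sq_integrable i w) (h.hess_variance i w)).sampleMean hK

theorem Assumptions.memLp_sampledModel (h : Assumptions α L ρ G σG σH ℓ D) (hK : 0 < K)
    (s : State d n) (i : Fin n) :
    MemLp (fun S : Fin K → Z => sampledModel α β ℓ s i S) 2 (pointsLaw K (D i)) := by
  have hfresh := ((h.isUnbiasedEstimator_batchGrad hK i s.w).const_sub_smul s.w α).memLp
  unfold sampledModel
  split_ifs
  · exact (memLp_const ((1 - β) • s.u i)).add (hfresh.const_smul β)
  · exact hfresh

theorem Assumptions.integrable_sampledModel_sub_sq (h : Assumptions α L ρ G σG σH ℓ D)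
    (hK : 0 < K) (s : State d n) (i : Fin n) (a : Vec d) :
    Integrable (fun S : Fin K → Z => ‖sampledModel α β ℓ s i S - a‖ ^ 2) (pointsLaw K (D i)) :=
  ((h.memLp_sampledModel hK s i).sub (memLp_const a)).integrable_norm_pow two_ne_zero

theorem Assumptions.integral_sampledModel_sub_sq_le (h : Assumptions α L ρ G σG σH ℓ D)
    (hK : 0 < K) (hβ₀ : 0 ≤ β) (hβ₁ : β ≤ 1) (s : State d n) (i : Fin n) :
    ∫ S, ‖sampledModel α β ℓ s i S - adapted α (risk ℓ D i) s.w‖ ^ 2 ∂(pointsLaw K (D i))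
      ≤ (1 - β) * taskError α σG ℓ D s i + β ^ 2 * (α ^ 2 * σG ^ 2) := by
  have hfresh := (h.isUnbiasedEstimator_batchGrad hK i s.w).const_sub_smul s.w α
  have hv : 0 ≤ α ^ 2 * σG ^ 2 := by positivity
  by_cases hi : i ∈ s.seen
  · have hmomentum : ∀ S : Fin K → Z, sampledModel α β ℓ s i S - adapted α (risk ℓ D i) s.w =
        (1 - β) • (s.u i - adapted α (risk ℓ D i) s.w)
          + β • (s.w - α • batchGrad (ℓ i) S s.w - adapted α (risk ℓ D i) s.w) := fun S => by
      simp only [sampledModel, if_pos hi]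
      module
    simp only [hmomentum, taskError, if_pos hi]
    refine (hfresh.integral_norm_add_smul_sub_sq_le _ β).trans ?_
    rw [norm_smul, mul_pow, Real.norm_eq_abs, sq_abs]
    gcongr
    nlinarith
  · simp only [sampledModel, taskError, if_neg hi]
    refine hfresh.variance_le.trans ?_
    -- `1 ≤ 2 (1 - β) + β²` because the difference is `(1 - β)²`
    nlinarith [mul_nonneg (sq_nonneg (1 - β)) hv]

/-- A bound for the second moment of the stochastic meta-gradient. -/
def gradMomentBound (α L G σG σH : ℝ) : ℝ :=
  2 * ((1 + α * L) ^ 2 + α ^ 2 * σH ^ 2) * (2 * (G ^ 2 + σG ^ 2))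

theorem gradMomentBound_nonneg : 0 ≤ gradMomentBound α L G σG σH := by
  unfold gradMomentBound; positivity

theorem Assumptions.integral_taskGrad_sq_le (h : Assumptions α L ρ G σG σH ℓ D) (hK : 0 < K)
    (hα : 0 ≤ α) (hL : 0 ≤ L) (s : State d n) (i : Fin n) :
    Integrable (fun S => ‖taskGrad α β ℓ s i S‖ ^ 2) (taskLaw K (D i)) ∧
      ∫ S, ‖taskGrad α β ℓ s i S‖ ^ 2 ∂(taskLaw K (D i)) ≤ gradMomentBound α L G σG σH := by
  have hJ := (h.isUnbiasedEstimator_batchHess hK i s.w).const_sub_smul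
    (ContinuousLinearMap.id ℝ (Vec d)) α
  have hg : ∀ S₁ : Fin K → Z, _ := fun S₁ =>
    h.isUnbiasedEstimator_batchGrad hK i (sampledModel α β ℓ s i S₁)
  have happly := fun S₁ => memLp_two_clm_apply_prod hJ.memLp (hg S₁).memLp
  refine integrable_prod_of_forall_integral_le
    ((h.measurable_taskGrad i measurable_const measurable_id).norm.pow_const 2).aestronglyMeasurable
    (fun _ => by positivity) (fun S₁ => (happly S₁).1.integrable_norm_pow two_ne_zero)
    fun S₁ => (happly S₁).2.trans ?_
  exact mul_le_mul (hJ.integral_norm_sq_le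
      (norm_id_sub_smul_fderiv_gradient_le hα hL (h.grad_lipschitz i) _))
    ((hg S₁).integral_norm_sq_le (h.grad_bounded i _))
    (integral_nonneg fun _ => by positivity) (by positivity)

theorem Assumptions.integrable_taskGrad (h : Assumptions α L ρ G σG σH ℓ D) (hK : 0 < K)
    (hα : 0 ≤ α) (hL : 0 ≤ L) (s : State d n) (i : Fin n) :
    Integrable (fun S => taskGrad α β ℓ s i S) (taskLaw K (D i)) :=
  ((memLp_two_iff_integrable_sq_norm
    (h.measurable_taskGrad i measurable_const measurable_id).aestronglyMeasurable).mpr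
    (h.integral_taskGrad_sq_le hK hα hL s i).1).integrable one_le_two

theorem Assumptions.integral_inner_taskGrad_mk (h : Assumptions α L ρ G σG σH ℓ D) (hK : 0 < K)
    (s : State d n) (i : Fin n) (a : Vec d) (S₁ : Fin K → Z) :
    ∫ S, inner ℝ a (taskGrad α β ℓ s i (S₁, S)) ∂((pointsLaw K (D i)).prod (pointsLaw K (D i))) =
      inner ℝ a ((ContinuousLinearMap.id ℝ (Vec d) - α • hess (risk ℓ D i) s.w)
        (∇ (risk ℓ D i) (sampledModel α β ℓ s i S₁))) := by
  have hJ := (h.isUnbiasedEstimator_batchHess hK i s.w).const_sub_smul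
    (ContinuousLinearMap.id ℝ (Vec d)) α
  have hg := h.isUnbiasedEstimator_batchGrad hK i (sampledModel α β ℓ s i S₁)
  have hmean := integral_prod_bilin (ContinuousLinearMap.id ℝ (Vec d →L[ℝ] Vec d)) hJ.integrable
    hg.integrable
  rw [hJ.integral_eq, hg.integral_eq] at hmean
  exact (integral_inner ((memLp_two_clm_apply_prod hJ.memLp hg.memLp).1.integrable one_le_two)
    a).trans (congrArg (inner ℝ a) hmean)

theorem Assumptions.le_integral_inner_taskGrad (h : Assumptions α L ρ G σG σH ℓ D) (hK : 0 < K)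
    (hα : 0 ≤ α) (hL : 0 ≤ L) (s : State d n) (i : Fin n) (a : Vec d) :
    inner ℝ a (adaptedGrad α (risk ℓ D i) s.w) - ‖a‖ ^ 2 / 2 - biasConst α L / 2 *
        ∫ S, ‖sampledModel α β ℓ s i S - adapted α (risk ℓ D i) s.w‖ ^ 2 ∂(pointsLaw K (D i))
      ≤ ∫ S, inner ℝ a (taskGrad α β ℓ s i S) ∂(taskLaw K (D i)) := by
  have herr := (h.integrable_sampledModel_sub_sq (β := β) hK s i
    (adapted α (risk ℓ D i) s.w)).const_mul (biasConst α L / 2)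
  have hgrad := (h.integrable_taskGrad (β := β) hK hα hL s i).const_inner (𝕜 := ℝ) a
  have hmono := integral_mono ((integrable_const _).sub herr) hgrad.integral_prod_left fun S₁ =>
    (le_inner_id_sub_smul_fderiv_gradient_apply hα hL (h.grad_lipschitz i) s.w
      (sampledModel α β ℓ s i S₁) a).trans_eq (h.integral_inner_taskGrad_mk hK s i a S₁).symm
  rw [integral_prod _ hgrad]
  refine le_of_eq_of_le ?_ hmono
  rw [← integral_const_mul, integral_sub' (integrable_const _) herr]
  simp

end SingleTask

section Sampling

instance (n B : ℕ) : Fintype (TaskBatch n B) :=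
  inferInstanceAs (Fintype {s : Finset (Fin n) // s.card = B})

instance (n B : ℕ) : DiscreteMeasurableSpace (TaskBatch n B) :=
  ⟨fun _ => trivial⟩

variable {n B K : ℕ} {Z : Type*}

theorem card_taskBatch : Fintype.card (TaskBatch n B) = n.choose B :=
  (Fintype.card_finset_len B).trans (by rw [Fintype.card_fin])

theorem nonempty_taskBatch (hBn : B ≤ n) : Nonempty (TaskBatch n B) :=
  Fintype.card_pos_iff.mp (card_taskBatch.symm ▸ Nat.choose_pos hBn)

theorem card_filter_mem_taskBatch (hB : 0 < B) (i : Fin n) :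
    (Finset.univ.filter fun b : TaskBatch n B => i ∈ b.1).card = (n - 1).choose (B - 1) := by
  have hcard := Finset.card_filter_powersetCard_subset {i} Finset.univ B (by simp) (by simpa)
  rw [Finset.card_singleton, Finset.card_univ, Fintype.card_fin] at hcard
  refine (Finset.card_bij (fun b _ => b.1) (fun b hb => ?_)
    (fun b _ b' _ => Subtype.ext) fun s hs => ?_).trans hcard
  · simpa [Finset.mem_powersetCard] using ⟨b.2, (Finset.mem_filter.mp hb).2⟩
  · obtain ⟨hs, his⟩ := Finset.mem_filter.mp hs
    exact ⟨⟨s, (Finset.mem_powersetCard.mp hs).2⟩, Finset.mem_filter.mpr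
      ⟨Finset.mem_univ _, Finset.singleton_subset_iff.mp his⟩, rfl⟩

theorem uniformOn_univ_real_mem_taskBatch (hB : 0 < B) (hBn : B ≤ n) (i : Fin n) :
    (uniformOn (Set.univ : Set (TaskBatch n B))).real {b | i ∈ b.1} = B / n := by
  obtain ⟨m, rfl⟩ := Nat.exists_eq_add_of_lt (hB.trans_le hBn)
  obtain ⟨k, rfl⟩ := Nat.exists_eq_add_of_lt hB
  have hchoose := Nat.add_one_mul_choose_eq m k
  have hset : {b : TaskBatch (0 + m + 1) (0 + k + 1) | i ∈ b.1} =
      ↑(Finset.univ.filter fun b : TaskBatch (0 + m + 1) (0 + k + 1) => i ∈ b.1) := by ext; simp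
  classical
  rw [Measure.real, hset, ← Finset.coe_univ, uniformOn_apply_finset, Finset.univ_inter,
    card_filter_mem_taskBatch hB, Finset.card_univ, card_taskBatch, ENNReal.toReal_div]
  have hpos : (0 : ℝ) < ((m + 1).choose (k + 1) : ℕ) := by
    exact_mod_cast Nat.choose_pos (by omega)
  simp only [ENNReal.toReal_natCast, zero_add, add_tsub_cancel_right]
  rw [div_eq_div_iff hpos.ne' (by positivity)]
  exact_mod_cast (mul_comm _ _).trans (hchoose.trans (mul_comm _ _))

/-- The part of the data `S` of one iteration that belongs to task `i`. -/
def taskSample (S : DataBatch n K Z × DataBatch n K Z × DataBatch n K Z) (i : Fin n) :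
    TaskSample K Z :=
  (S.1 i, S.2.1 i, S.2.2 i)

variable [MeasurableSpace Z]

theorem measurable_taskSample (i : Fin n) :
    Measurable fun S : DataBatch n K Z × DataBatch n K Z × DataBatch n K Z => taskSample S i := by
  unfold taskSample
  fun_prop

variable {D : Fin n → Measure Z} [∀ i, IsProbabilityMeasure (D i)]

instance : IsProbabilityMeasure (dataLaw K D) := by
  unfold dataLaw
  infer_instance

theorem isProbabilityMeasure_stepLaw (hBn : B ≤ n) : IsProbabilityMeasure (stepLaw B K D) := by
  have := nonempty_taskBatch hBn
  unfold stepLaw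
  infer_instance

theorem measurePreserving_taskSample (i : Fin n) :
    MeasurePreserving (fun S => taskSample S i)
      ((dataLaw K D).prod ((dataLaw K D).prod (dataLaw K D))) (taskLaw K (D i)) := by
  have heval : MeasurePreserving (fun S : Fin n → Fin K → Z => S i) (dataLaw K D)
      (pointsLaw K (D i)) := measurePreserving_eval (fun i => pointsLaw K (D i)) i
  exact heval.prod (heval.prod heval)

theorem integral_indicator_mem_mul_taskSample (hB : 0 < B) (hBn : B ≤ n) (i : Fin n)
    {φ : TaskSample K Z → ℝ} (hφ : Integrable φ (taskLaw K (D i))) :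
    Integrable (fun x => Set.indicator {b : TaskBatch n B | i ∈ b.1} (1 : TaskBatch n B → ℝ) x.1 *
        φ (taskSample x.2 i)) (stepLaw B K D) ∧
      ∫ x, Set.indicator {b : TaskBatch n B | i ∈ b.1} (1 : TaskBatch n B → ℝ) x.1 *
        φ (taskSample x.2 i) ∂(stepLaw B K D) = B / n * ∫ S, φ S ∂(taskLaw K (D i)) := by
  have := nonempty_taskBatch hBn
  have hdata := measurePreserving_taskSample (K := K) (D := D) i
  refine ⟨((integrable_const 1).indicator .of_discrete).mul_prod
    (hdata.integrable_comp_of_integrable hφ), ?_⟩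
  rw [stepLaw, integral_prod_mul _ fun S => φ (taskSample S i),
    integral_indicator_one .of_discrete, uniformOn_univ_real_mem_taskBatch hB hBn,
    ← hdata.map_eq, integral_map hdata.aemeasurable (hdata.map_eq ▸ hφ.aestronglyMeasurable)]

theorem integral_inv_mul_sum_taskSample (hB : 0 < B) (hBn : B ≤ n)
    {φ : Fin n → TaskSample K Z → ℝ} (hφ : ∀ i, Integrable (φ i) (taskLaw K (D i))) :
    Integrable (fun x => (B : ℝ)⁻¹ * ∑ i ∈ x.1.1, φ i (taskSample x.2 i)) (stepLaw B K D) ∧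
      ∫ x, (B : ℝ)⁻¹ * ∑ i ∈ x.1.1, φ i (taskSample x.2 i) ∂(stepLaw B K D) =
        (n : ℝ)⁻¹ * ∑ i, ∫ S, φ i S ∂(taskLaw K (D i)) := by
  have hsum : ∀ x : StepSample n B K Z, ∑ i ∈ x.1.1, φ i (taskSample x.2 i) =
      ∑ i, Set.indicator {b : TaskBatch n B | i ∈ b.1} (1 : TaskBatch n B → ℝ) x.1 *
        φ i (taskSample x.2 i) := fun x => by
    simp [Set.indicator_apply]
  have hterm := fun i => integral_indicator_mem_mul_taskSample hB hBn i (hφ i)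
  have hB' : (B : ℝ) ≠ 0 := by positivity
  simp only [hsum]
  refine ⟨(integrable_finsetSum _ fun i _ => (hterm i).1).const_mul _, ?_⟩
  rw [integral_const_mul, integral_finsetSum _ fun i _ => (hterm i).1, Finset.mul_sum,
    Finset.mul_sum]
  refine Finset.sum_congr rfl fun i _ => ?_
  rw [(hterm i).2]
  field_simp

end Sampling

section Iteration

variable {d n B K : ℕ} {Z : Type*} {α η β L ρ G σG σH : ℝ} {ℓ : Fin n → Vec d → Z → ℝ}

theorem updateU_eq_ite (s : State d n) (b : TaskBatch n B) (S : DataBatch n K Z) (i : Fin n) :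
    updateU α β ℓ s b S i = if i ∈ b.1 then sampledModel α β ℓ s i (S i) else s.u i :=
  rfl

theorem metaGrad_updateU (s : State d n) (x : StepSample n B K Z) :
    metaGrad α ℓ s.w (updateU α β ℓ s x.1 x.2.1) x.1 x.2.2.1 x.2.2.2 =
      (B : ℝ)⁻¹ • ∑ i ∈ x.1.1, taskGrad α β ℓ s i (taskSample x.2 i) := by
  unfold metaGrad taskGrad
  congr 1
  refine Finset.sum_congr rfl fun i hi => ?_
  rw [updateU_eq_ite, if_pos hi, taskSample]

theorem norm_step_w_sub_sq_le (s : State d n) (x : StepSample n B K Z) :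
    ‖(step α η β ℓ s x).w - s.w‖ ^ 2 ≤
      η ^ 2 * ((B : ℝ)⁻¹ * ∑ i ∈ x.1.1, ‖taskGrad α β ℓ s i (taskSample x.2 i)‖ ^ 2) := by
  have hmean := norm_inv_card_smul_sum_sq_le x.1.1 fun i => taskGrad α β ℓ s i (taskSample x.2 i)
  rw [x.1.2] at hmean
  rw [step, metaGrad_updateU, sub_sub_cancel_left, norm_neg, norm_smul, mul_pow, Real.norm_eq_abs,
    sq_abs]
  gcongr

variable [MeasurableSpace Z] {D : Fin n → Measure Z}

theorem Assumptions.measurable_step (h : Assumptions α L ρ G σG σH ℓ D) :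
    Measurable fun p : State d n × StepSample n B K Z => step α η β ℓ p.1 p.2 := by
  have hmem : ∀ i, MeasurableSet {p : State d n × StepSample n B K Z | i ∈ p.2.1.1} := fun i =>
    (measurable_fst.comp measurable_snd)
      (MeasurableSet.of_discrete : MeasurableSet {b : TaskBatch n B | i ∈ b.1})
  have hseen : ∀ i, MeasurableSet {p : State d n × StepSample n B K Z | i ∈ p.1.seen} := fun i =>
    measurable_fst (measurableSet_mem_seen i)
  refine measurable_state_iff.mpr ⟨?_, fun i => ?_, fun i => ?_⟩
  · have hgrad : Measurable fun p : State d n × StepSample n B K Z =>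
        ∑ i, if i ∈ p.2.1.1 then taskGrad α β ℓ p.1 i (taskSample p.2.2 i) else 0 :=
      Finset.measurable_fun_sum _ fun i _ => Measurable.ite (hmem i)
        (h.measurable_taskGrad i measurable_fst
          ((measurable_taskSample i).comp measurable_snd.snd)) measurable_const
    simp only [Finset.sum_ite_mem, Finset.univ_inter] at hgrad
    simp only [step, metaGrad_updateU]
    exact (measurable_state_w.comp measurable_fst).sub
      ((hgrad.const_smul (B : ℝ)⁻¹).const_smul η)
  · exact Measurable.ite (hmem i) (h.measurable_sampledModel i measurable_fst
      ((measurable_pi_apply i).comp measurable_snd.snd.fst))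
      ((measurable_state_u i).comp measurable_fst)
  · simpa [step, Set.ofPred_or] using (hseen i).union (hmem i)

end Iteration

section Potential

variable {d n B K : ℕ} {Z : Type*} [MeasurableSpace Z] {α η β L ρ G σG σH A H c : ℝ}
  {ℓ : Fin n → Vec d → Z → ℝ} {D : Fin n → Measure Z}

theorem norm_sub_sq_le_add {E : Type*} [SeminormedAddCommGroup E] (hc : 0 < c) (x y z : E) :
    ‖x - z‖ ^ 2 ≤ (1 + c) * ‖x - y‖ ^ 2 + (1 + c⁻¹) * ‖z - y‖ ^ 2 := by
  have htriangle : ‖x - z‖ ≤ ‖x - y‖ + ‖z - y‖ := by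
    simpa using norm_sub_le (x - y) (z - y)
  have hyoung : 2 * ‖x - y‖ * ‖z - y‖ ≤ c * ‖x - y‖ ^ 2 + c⁻¹ * ‖z - y‖ ^ 2 := by
    have hsq : c * ‖x - y‖ ^ 2 + c⁻¹ * ‖z - y‖ ^ 2 - 2 * ‖x - y‖ * ‖z - y‖ =
        c⁻¹ * (c * ‖x - y‖ - ‖z - y‖) ^ 2 := by
      field_simp
      ring
    exact sub_nonneg.mp (hsq ▸ by positivity)
  calc ‖x - z‖ ^ 2 ≤ (‖x - y‖ + ‖z - y‖) ^ 2 := by gcongr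
    _ ≤ (1 + c) * ‖x - y‖ ^ 2 + (1 + c⁻¹) * ‖z - y‖ ^ 2 := by linarith

/-- The tracking error of the personalized models, averaged over the tasks. -/
def meanTaskError (α σG : ℝ) (ℓ : Fin n → Vec d → Z → ℝ) (D : Fin n → Measure Z)
    (s : State d n) : ℝ :=
  (n : ℝ)⁻¹ * ∑ i, taskError α σG ℓ D s i

/-- The Lyapunov function of the algorithm: the optimality gap of the meta-model plus `A` times the
tracking error of the personalized models. -/
def potential (A α σG : ℝ) (ℓ : Fin n → Vec d → Z → ℝ) (D : Fin n → Measure Z)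
    (s : State d n) : ℝ :=
  metaObjective α ℓ D s.w - (⨅ w, metaObjective α ℓ D w) + A * meanTaskError α σG ℓ D s

/-- What a sampled task with the data `S` contributes to the increase of the potential in one
iteration, when the tracking error has weight `A` and squared displacements have weight `H`. -/
def increment (A H α η β σG : ℝ) (ℓ : Fin n → Vec d → Z → ℝ) (D : Fin n → Measure Z)
    (s : State d n) (i : Fin n) (S : TaskSample K Z) : ℝ :=
  -(η * inner ℝ (∇ (metaObjective α ℓ D) s.w) (taskGrad α β ℓ s i S))
    + H * η ^ 2 * ‖taskGrad α β ℓ s i S‖ ^ 2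
    + A * (‖sampledModel α β ℓ s i S.1 - adapted α (risk ℓ D i) s.w‖ ^ 2 - taskError α σG ℓ D s i)

theorem meanTaskError_nonneg (s : State d n) : 0 ≤ meanTaskError α σG ℓ D s :=
  mul_nonneg (by positivity) (Finset.sum_nonneg fun i _ => taskError_nonneg s i)

theorem Assumptions.potential_nonneg (h : Assumptions α L ρ G σG σH ℓ D) (hA : 0 ≤ A)
    (s : State d n) : 0 ≤ potential A α σG ℓ D s :=
  add_nonneg (sub_nonneg.mpr (ciInf_le h.bddBelow s.w)) (mul_nonneg hA (meanTaskError_nonneg s))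

theorem Assumptions.measurable_potential (h : Assumptions α L ρ G σG σH ℓ D) :
    Measurable (potential A α σG ℓ D) :=
  ((h.continuous_metaObjective.measurable.comp measurable_state_w).sub_const _).add
    (((Finset.measurable_fun_sum _ fun i _ => h.measurable_taskError i).const_mul _).const_mul A)

theorem Assumptions.taskError_step_le (h : Assumptions α L ρ G σG σH ℓ D) (hα : 0 ≤ α)
    (hc : 0 < c) (s : State d n) (x : StepSample n B K Z) (i : Fin n) :
    taskError α σG ℓ D (step α η β ℓ s x) i ≤
      (1 + c) * (if i ∈ x.1.1 then
          ‖sampledModel α β ℓ s i (taskSample x.2 i).1 - adapted α (risk ℓ D i) s.w‖ ^ 2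
        else taskError α σG ℓ D s i)
      + (1 + c⁻¹) * ((1 + α * L) ^ 2 * ‖(step α η β ℓ s x).w - s.w‖ ^ 2) := by
  have hmove : ∀ u, ‖u - adapted α (risk ℓ D i) (step α η β ℓ s x).w‖ ^ 2 ≤
      (1 + c) * ‖u - adapted α (risk ℓ D i) s.w‖ ^ 2
        + (1 + c⁻¹) * ((1 + α * L) ^ 2 * ‖(step α η β ℓ s x).w - s.w‖ ^ 2) := fun u => by
    refine (norm_sub_sq_le_add hc u (adapted α (risk ℓ D i) s.w) _).trans ?_
    rw [← mul_pow]
    gcongr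
    exact norm_adapted_sub_le hα (h.grad_lipschitz i) _ _
  by_cases hb : i ∈ x.1.1
  · have hseen : i ∈ (step α η β ℓ s x).seen := Finset.mem_union_right _ hb
    have hu : (step α η β ℓ s x).u i = sampledModel α β ℓ s i (taskSample x.2 i).1 := if_pos hb
    rw [taskError, if_pos hseen, if_pos hb, hu]
    exact hmove _
  · have hseen : i ∈ (step α η β ℓ s x).seen ↔ i ∈ s.seen := by simp [step, hb]
    have hu : (step α η β ℓ s x).u i = s.u i := if_neg hb
    simp only [taskError, hseen, if_neg hb, hu]
    split_ifs
    · exact hmove _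
    · have hinit : 0 ≤ c * (2 * (α ^ 2 * σG ^ 2)) := by positivity
      have hdisp : 0 ≤ (1 + c⁻¹) * ((1 + α * L) ^ 2 * ‖(step α η β ℓ s x).w - s.w‖ ^ 2) := by
        positivity
      linarith

theorem Assumptions.meanTaskError_step_le (h : Assumptions α L ρ G σG σH ℓ D) (hn : 0 < n)
    (hα : 0 ≤ α) (hc : 0 < c) (s : State d n) (x : StepSample n B K Z) :
    meanTaskError α σG ℓ D (step α η β ℓ s x) ≤
      (1 + c) * (meanTaskError α σG ℓ D s + (n : ℝ)⁻¹ * ∑ i ∈ x.1.1,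
        (‖sampledModel α β ℓ s i (taskSample x.2 i).1 - adapted α (risk ℓ D i) s.w‖ ^ 2
          - taskError α σG ℓ D s i))
      + (1 + c⁻¹) * ((1 + α * L) ^ 2 * ‖(step α η β ℓ s x).w - s.w‖ ^ 2) := by
  have hsplit : ∀ q E : Fin n → ℝ, ∑ i, (if i ∈ x.1.1 then q i else E i) =
      ∑ i, E i + ∑ i ∈ x.1.1, (q i - E i) := fun q E => by
    rw [← Finset.univ_inter x.1.1, ← Finset.sum_ite_mem, ← Finset.sum_add_distrib]
    refine Finset.sum_congr rfl fun i _ => ?_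
    simp only [Finset.univ_inter]
    split_ifs <;> ring
  refine (mul_le_mul_of_nonneg_left (Finset.sum_le_sum fun i _ =>
    h.taskError_step_le hα hc s x i) (by positivity)).trans_eq ?_
  rw [Finset.sum_add_distrib, ← Finset.mul_sum, hsplit, Finset.sum_const, Finset.card_univ,
    Fintype.card_fin, nsmul_eq_mul, meanTaskError]
  field_simp

theorem Assumptions.potential_step_le (h : Assumptions α L ρ G σG σH ℓ D) (hn : 0 < n) (hB : 0 < B)
    (hα : 0 ≤ α) (hL : 0 ≤ L) (hρ : 0 ≤ ρ) (hG : 0 ≤ G) (hA : 0 ≤ A) (hc : 0 < c)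
    (s : State d n) (x : StepSample n B K Z) :
    potential A α σG ℓ D (step α η β ℓ s x) ≤
      potential (A * (1 + c)) α σG ℓ D s + (B : ℝ)⁻¹ * ∑ i ∈ x.1.1,
        increment (A * (1 + c) * (B / n)) (adaptedSmoothness α L ρ G
          + A * (1 + c⁻¹) * (1 + α * L) ^ 2) α η β σG ℓ D s i (taskSample x.2 i) := by
  have hdisp := norm_step_w_sub_sq_le (η := η) (α := α) (β := β) (ℓ := ℓ) s x
  have hsmooth : 0 ≤ adaptedSmoothness α L ρ G + A * (1 + c⁻¹) * (1 + α * L) ^ 2 :=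
    add_nonneg (adaptedSmoothness_nonneg hα hL hρ hG) (by positivity)
  have hinner : inner ℝ (∇ (metaObjective α ℓ D) s.w) ((step α η β ℓ s x).w - s.w) =
      (B : ℝ)⁻¹ * ∑ i ∈ x.1.1, -(η * inner ℝ (∇ (metaObjective α ℓ D) s.w)
        (taskGrad α β ℓ s i (taskSample x.2 i))) := by
    rw [step, metaGrad_updateU, sub_sub_cancel_left, inner_neg_right, inner_smul_right,
      inner_smul_right, inner_sum, Finset.sum_neg_distrib, ← Finset.mul_sum]
    ring
  have hdescent := h.metaObjective_descent hn hα hL hρ hG s.w (step α η β ℓ s x).w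
  have herr := mul_le_mul_of_nonneg_left (h.meanTaskError_step_le (η := η) (β := β) hn hα hc s x) hA
  have hscale : ∀ e : ℝ, (B : ℝ)⁻¹ * (A * (1 + c) * (B / n) * e) =
      A * (1 + c) * ((n : ℝ)⁻¹ * e) := fun e => by field_simp
  rw [hinner] at hdescent
  simp only [potential, increment, Finset.sum_add_distrib, ← Finset.mul_sum, mul_add (B : ℝ)⁻¹,
    hscale]
  linear_combination hdescent + herr + mul_le_mul_of_nonneg_left hdisp hsmooth

variable [∀ i, IsProbabilityMeasure (D i)]

theorem Assumptions.integral_increment (h : Assumptions α L ρ G σG σH ℓ D) (hK : 0 < K)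
    (hα : 0 ≤ α) (hL : 0 ≤ L) (s : State d n) (i : Fin n) :
    Integrable (increment A H α η β σG ℓ D s i) (taskLaw K (D i)) ∧
      ∫ S, increment A H α η β σG ℓ D s i S ∂(taskLaw K (D i)) =
        -(η * ∫ S, inner ℝ (∇ (metaObjective α ℓ D) s.w) (taskGrad α β ℓ s i S)
            ∂(taskLaw K (D i)))
          + H * η ^ 2 * ∫ S, ‖taskGrad α β ℓ s i S‖ ^ 2 ∂(taskLaw K (D i))
          + A * ((∫ S, ‖sampledModel α β ℓ s i S - adapted α (risk ℓ D i) s.w‖ ^ 2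
            ∂(pointsLaw K (D i))) - taskError α σG ℓ D s i) := by
  have hinner := (((h.integrable_taskGrad (β := β) hK hα hL s i).const_inner (𝕜 := ℝ)
    (∇ (metaObjective α ℓ D) s.w)).const_mul η).neg
  have hsq := (h.integral_taskGrad_sq_le (β := β) hK hα hL s i).1.const_mul (H * η ^ 2)
  have herr : Integrable (fun S : TaskSample K Z => ‖sampledModel α β ℓ s i S.1
      - adapted α (risk ℓ D i) s.w‖ ^ 2) (taskLaw K (D i)) :=
    (h.integrable_sampledModel_sub_sq hK s i _).comp_fst _
  have hdiff := (herr.sub (integrable_const (taskError α σG ℓ D s i))).const_mul A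
  refine ⟨(hinner.add hsq).add hdiff, ?_⟩
  refine (integral_add' (hinner.add hsq) hdiff).trans ?_
  rw [integral_add' hinner hsq]
  simp only [Pi.neg_apply, Pi.sub_apply, integral_neg, integral_const_mul]
  rw [integral_sub herr (integrable_const _), integral_fun_fst (fun S => ‖sampledModel α β ℓ s i S
    - adapted α (risk ℓ D i) s.w‖ ^ 2)]
  simp

theorem Assumptions.integral_increment_le (h : Assumptions α L ρ G σG σH ℓ D) (hK : 0 < K)
    (hα : 0 ≤ α) (hL : 0 ≤ L) (hη : 0 ≤ η) (hβ₀ : 0 ≤ β) (hβ₁ : β ≤ 1) (hA : 0 ≤ A) (hH : 0 ≤ H)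
    (s : State d n) (i : Fin n) :
    ∫ S, increment A H α η β σG ℓ D s i S ∂(taskLaw K (D i)) ≤
      -(η * inner ℝ (∇ (metaObjective α ℓ D) s.w) (adaptedGrad α (risk ℓ D i) s.w))
        + η / 2 * ‖∇ (metaObjective α ℓ D) s.w‖ ^ 2
        + (η * biasConst α L / 2 - A * β) * taskError α σG ℓ D s i
        + ((η * biasConst α L / 2 + A) * (β ^ 2 * (α ^ 2 * σG ^ 2))
          + H * η ^ 2 * gradMomentBound α L G σG σH) := by
  have hbias := h.le_integral_inner_taskGrad (β := β) hK hα hL s i (∇ (metaObjective α ℓ D) s.w)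
  have htrack := h.integral_sampledModel_sub_sq_le hK hβ₀ hβ₁ s i
  have hmoment := (h.integral_taskGrad_sq_le (β := β) hK hα hL s i).2
  have hκ : 0 ≤ η * biasConst α L / 2 := by
    have := biasConst_nonneg (α := α) (L := L)
    positivity
  have hdrop := mul_nonneg (mul_nonneg hκ hβ₀) (taskError_nonneg (ℓ := ℓ) (D := D) (α := α)
    (σG := σG) s i)
  rw [(h.integral_increment hK hα hL s i).2]
  linear_combination η * hbias + (η * biasConst α L / 2 + A) * htrack + H * η ^ 2 * hmoment + hdrop

/-- The noise that enters the potential in one iteration. -/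
def driftNoise (A H α η β L G σG σH : ℝ) : ℝ :=
  (η * biasConst α L / 2 + A) * (β ^ 2 * (α ^ 2 * σG ^ 2))
    + H * η ^ 2 * gradMomentBound α L G σG σH

theorem Assumptions.mean_integral_increment_le (h : Assumptions α L ρ G σG σH ℓ D) (hn : 0 < n)
    (hK : 0 < K) (hα : 0 ≤ α) (hL : 0 ≤ L) (hη : 0 ≤ η) (hβ₀ : 0 ≤ β) (hβ₁ : β ≤ 1) (hA : 0 ≤ A)
    (hH : 0 ≤ H) (s : State d n) :
    (n : ℝ)⁻¹ * ∑ i, ∫ S, increment A H α η β σG ℓ D s i S ∂(taskLaw K (D i)) ≤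
      -(η / 2 * ‖∇ (metaObjective α ℓ D) s.w‖ ^ 2)
        + (η * biasConst α L / 2 - A * β) * meanTaskError α σG ℓ D s
        + driftNoise A H α η β L G σG σH := by
  have hgrad : (n : ℝ)⁻¹ * ∑ i, inner ℝ (∇ (metaObjective α ℓ D) s.w)
      (adaptedGrad α (risk ℓ D i) s.w) = ‖∇ (metaObjective α ℓ D) s.w‖ ^ 2 := by
    rw [← real_inner_self_eq_norm_sq]
    nth_rw 3 [h.gradient_metaObjective]
    rw [inner_smul_right, inner_sum]
  refine (mul_le_mul_of_nonneg_left (Finset.sum_le_sum fun i _ =>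
    h.integral_increment_le hK hα hL hη hβ₀ hβ₁ hA hH s i) (by positivity)).trans_eq ?_
  simp only [Finset.sum_add_distrib, Finset.sum_neg_distrib, ← Finset.mul_sum, Finset.sum_const,
    Finset.card_univ, Fintype.card_fin, nsmul_eq_mul, driftNoise, meanTaskError]
  rw [← hgrad]
  field_simp
  ring

theorem Assumptions.integral_potential_step_le (h : Assumptions α L ρ G σG σH ℓ D) (hB : 0 < B)
    (hBn : B ≤ n) (hK : 0 < K) (hα : 0 ≤ α) (hL : 0 ≤ L) (hρ : 0 ≤ ρ) (hG : 0 ≤ G) (hη : 0 ≤ η)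
    (hβ₀ : 0 ≤ β) (hβ₁ : β ≤ 1) (hA : 0 ≤ A) (hc : 0 < c)
    (hdrift : A * (1 + c) * (1 - B / n * β) + η * biasConst α L / 2 ≤ A) (s : State d n) :
    Integrable (fun x => potential A α σG ℓ D (step α η β ℓ s x)) (stepLaw B K D) ∧
      ∫ x, potential A α σG ℓ D (step α η β ℓ s x) ∂(stepLaw B K D)
          + η / 2 * ‖∇ (metaObjective α ℓ D) s.w‖ ^ 2 ≤
        potential A α σG ℓ D s + driftNoise (A * (1 + c) * (B / n))
          (adaptedSmoothness α L ρ G + A * (1 + c⁻¹) * (1 + α * L) ^ 2) α η β L G σG σH := by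
  have hn := hB.trans_le hBn
  have := isProbabilityMeasure_stepLaw (K := K) (D := D) hBn
  have hH : 0 ≤ adaptedSmoothness α L ρ G + A * (1 + c⁻¹) * (1 + α * L) ^ 2 :=
    add_nonneg (adaptedSmoothness_nonneg hα hL hρ hG) (by positivity)
  have hmean := h.mean_integral_increment_le hn hK hα hL hη hβ₀ hβ₁
    (A := A * (1 + c) * (B / n)) (by positivity) hH s
  obtain ⟨hincr, hincr_eq⟩ := integral_inv_mul_sum_taskSample hB hBn fun i =>
    (h.integral_increment (A := A * (1 + c) * (B / n)) (H := adaptedSmoothness α L ρ G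
      + A * (1 + c⁻¹) * (1 + α * L) ^ 2) (η := η) (β := β) hK hα hL s i).1
  have hbound := (integrable_const (potential (A * (1 + c)) α σG ℓ D s)).add hincr
  have hstep := fun x : StepSample n B K Z =>
    h.potential_step_le (η := η) (β := β) hn hB hα hL hρ hG hA hc s x
  have hint : Integrable (fun x => potential A α σG ℓ D (step α η β ℓ s x)) (stepLaw B K D) :=
    hbound.mono' (h.measurable_potential.comp
      (h.measurable_step.comp measurable_prodMk_left)).aestronglyMeasurable <|
      .of_forall fun x => (Real.norm_of_nonneg (h.potential_nonneg hA _)).trans_le (hstep x)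
  refine ⟨hint, ?_⟩
  have hmono := integral_mono hint hbound hstep
  rw [integral_add' (integrable_const _) hincr, hincr_eq, integral_const, probReal_univ,
    one_smul] at hmono
  simp only [potential] at hmono ⊢
  have hweight := mul_le_mul_of_nonneg_right hdrift
    (meanTaskError_nonneg (α := α) (σG := σG) (ℓ := ℓ) (D := D) s)
  linear_combination hmono + hmean + hweight

end Potential

section UniformIndex

variable {ι E Ω : Type*} [Fintype ι] [MeasurableSpace ι]

theorem lintegral_uniformOn_univ [MeasurableSingletonClass ι] (f : ι → ENNReal) :
    ∫⁻ i, f i ∂(uniformOn (Set.univ : Set ι)) = (Fintype.card ι : ENNReal)⁻¹ * ∑ i, f i := by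
  rw [uniformOn, ProbabilityTheory.cond, Measure.restrict_univ, lintegral_smul_measure,
    lintegral_fintype, Measure.count_univ, ENat.card_eq_coe_fintype_card]
  simp

variable [DiscreteMeasurableSpace ι] [MeasurableSpace E] [MeasurableSpace Ω] {P : Measure Ω}
  [IsFiniteMeasure P]

theorem lintegral_uniform_index {τ : Ω → ι} {Y : Ω → E} (hτ : Measurable τ) (hY : Measurable Y)
    (hunif : P.map τ = uniformOn Set.univ) (hindep : IndepFun τ Y P) {g : ι → E → ENNReal}
    (hg : ∀ i, Measurable (g i)) :
    ∫⁻ ω, g (τ ω) (Y ω) ∂P = (Fintype.card ι : ENNReal)⁻¹ * ∑ i, ∫⁻ ω, g i (Y ω) ∂P := by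
  have hprod := (indepFun_iff_map_prod_eq_prod_map_map hτ.aemeasurable hY.aemeasurable).mp hindep
  have hg' : Measurable fun p : ι × E => g p.1 p.2 := measurable_from_prod_countable_right hg
  calc ∫⁻ ω, g (τ ω) (Y ω) ∂P = ∫⁻ p, g p.1 p.2 ∂(P.map fun ω => (τ ω, Y ω)) := by
        rw [lintegral_map hg' (hτ.prodMk hY)]
    _ = _ := by
        rw [hprod, lintegral_prod _ hg'.aemeasurable, hunif, lintegral_uniformOn_univ]
        simp only [lintegral_map (hg _) hY]

end UniformIndex

section RandomRecursion

variable {S E Ω : Type*} {f : S → E → S} {s₀ : S}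

/-- The trajectory `Y₀ = s₀`, `Yₜ₊₁ = f Yₜ xₜ` of the recursion `f` driven by `x`. -/
def trajectory (f : S → E → S) (s₀ : S) (x : ℕ → E) : ℕ → S
  | 0 => s₀
  | t + 1 => f (trajectory f s₀ x t) (x t)

variable [MeasurableSpace S] [MeasurableSpace E]

theorem measurable_trajectory (hf : Measurable (Function.uncurry f)) (t : ℕ) :
    Measurable fun x => trajectory f s₀ x t := by
  induction t with
  | zero => exact measurable_const
  | succ t ih => exact hf.comp (ih.prodMk (measurable_pi_apply t))

variable [MeasurableSpace Ω] {P : Measure Ω} {X : ℕ → Ω → E}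

theorem measurable_trajectory_index (hf : Measurable (Function.uncurry f))
    (hX : ∀ t, Measurable (X t)) {T : ℕ} {τ : Ω → Fin T} (hτ : Measurable τ) :
    Measurable fun ω => trajectory f s₀ (fun t => X t ω) (τ ω) := by
  have hjoint : Measurable fun p : Fin T × (ℕ → E) => trajectory f s₀ p.2 p.1 :=
    measurable_from_prod_countable_right fun t => measurable_trajectory hf t
  exact hjoint.comp (hτ.prodMk (measurable_pi_iff.mpr hX))

theorem indepFun_trajectory (hf : Measurable (Function.uncurry f)) (hX : ∀ t, Measurable (X t))
    (hind : iIndepFun X P) (t : ℕ) :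
    IndepFun (fun ω => trajectory f s₀ (fun j => X j ω) t) (X t) P := by
  let past (t : ℕ) : MeasurableSpace Ω := ⨆ j ∈ Set.Iio t, MeasurableSpace.comap (X j) inferInstance
  have hpast : ∀ t, Measurable[past t] fun ω => trajectory f s₀ (fun j => X j ω) t := by
    intro t
    induction t with
    | zero => exact measurable_const
    | succ t ih =>
      have hle : past t ≤ past (t + 1) :=
        biSup_mono fun j hj => Set.Iio_subset_Iio t.le_succ hj
      have hXt : MeasurableSpace.comap (X t) inferInstance ≤ past (t + 1) :=
        le_biSup (fun j => MeasurableSpace.comap (X j) inferInstance)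
          (Set.mem_Iio.mpr (Nat.lt_add_one t))
      exact hf.comp ((ih.mono hle le_rfl).prodMk ((comap_measurable (X t)).mono hXt le_rfl))
  have hindep := indep_iSup_of_disjoint (fun j => (hX j).comap_le) hind
    (S := Set.Iio t) (T := {t}) (by simp)
  rw [IndepFun_iff_Indep]
  exact indep_of_indep_of_le_right (indep_of_indep_of_le_left hindep (hpast t).comap_le)
    (le_biSup (fun j => MeasurableSpace.comap (X j) inferInstance) (Set.mem_singleton t))

theorem lintegral_trajectory_succ [IsFiniteMeasure P] {μ : Measure E}
    (hf : Measurable (Function.uncurry f)) (hX : ∀ t, Measurable (X t)) (hind : iIndepFun X P)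
    (hlaw : ∀ t, P.map (X t) = μ) {V : S → ENNReal} (hV : Measurable V) (t : ℕ) :
    ∫⁻ ω, V (trajectory f s₀ (fun j => X j ω) (t + 1)) ∂P =
      ∫⁻ ω, ∫⁻ x, V (f (trajectory f s₀ (fun j => X j ω) t) x) ∂μ ∂P := by
  have hY : Measurable fun ω => trajectory f s₀ (fun j => X j ω) t :=
    (measurable_trajectory hf t).comp (measurable_pi_iff.mpr hX)
  have hprod := (indepFun_iff_map_prod_eq_prod_map_map hY.aemeasurable (hX t).aemeasurable).mp
    (indepFun_trajectory hf hX hind t)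
  have hVf : Measurable fun p : S × E => V (f p.1 p.2) := hV.comp hf
  have : IsFiniteMeasure μ := hlaw t ▸ inferInstance
  calc ∫⁻ ω, V (trajectory f s₀ (fun j => X j ω) (t + 1)) ∂P
      = ∫⁻ p, V (f p.1 p.2) ∂(P.map fun ω => (trajectory f s₀ (fun j => X j ω) t, X t ω)) := by
        rw [lintegral_map hVf (hY.prodMk (hX t))]
        rfl
    _ = _ := by
        rw [hprod, hlaw t, lintegral_prod _ hVf.aemeasurable,
          lintegral_map hVf.lintegral_prod_right' hY]

theorem lintegral_trajectory_add_sum_le [IsProbabilityMeasure P] {μ : Measure E}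
    (hf : Measurable (Function.uncurry f)) (hX : ∀ t, Measurable (X t)) (hind : iIndepFun X P)
    (hlaw : ∀ t, P.map (X t) = μ) {V g : S → ENNReal} (hV : Measurable V) (hg : Measurable g)
    {κ : ENNReal} (hdrift : ∀ s, ∫⁻ x, V (f s x) ∂μ + g s ≤ V s + κ) (T : ℕ) :
    ∫⁻ ω, V (trajectory f s₀ (fun j => X j ω) T) ∂P
        + ∑ t ∈ Finset.range T, ∫⁻ ω, g (trajectory f s₀ (fun j => X j ω) t) ∂P ≤
      V s₀ + T * κ := by
  induction T with
  | zero => simp [trajectory]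
  | succ t ih =>
    have hY : Measurable fun ω => trajectory f s₀ (fun j => X j ω) t :=
      (measurable_trajectory hf t).comp (measurable_pi_iff.mpr hX)
    have hone : ∫⁻ ω, V (trajectory f s₀ (fun j => X j ω) (t + 1)) ∂P
        + ∫⁻ ω, g (trajectory f s₀ (fun j => X j ω) t) ∂P ≤
        ∫⁻ ω, V (trajectory f s₀ (fun j => X j ω) t) ∂P + κ := by
      have hgY : Measurable fun ω => g (trajectory f s₀ (fun j => X j ω) t) := hg.comp hY
      rw [lintegral_trajectory_succ hf hX hind hlaw hV t, ← lintegral_add_right _ hgY]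
      refine (lintegral_mono fun ω => hdrift _).trans_eq ?_
      rw [lintegral_add_right _ measurable_const, lintegral_const, measure_univ, mul_one]
    rw [Finset.sum_range_succ, add_comm (Finset.sum _ _), ← add_assoc]
    refine (add_le_add_left hone _).trans ?_
    rw [add_right_comm]
    refine (add_le_add_left ih κ).trans_eq ?_
    push_cast
    ring

theorem lintegral_trajectory_uniform_le [IsProbabilityMeasure P] {μ : Measure E}
    (hf : Measurable (Function.uncurry f)) (hX : ∀ t, Measurable (X t)) (hind : iIndepFun X P)
    (hlaw : ∀ t, P.map (X t) = μ) {T : ℕ} {τ : Ω → Fin T} (hτ : Measurable τ)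
    (hunif : P.map τ = uniformOn Set.univ) (hindep : IndepFun τ (fun ω t => X t ω) P)
    {V g : S → ENNReal} (hV : Measurable V) (hg : Measurable g) {κ : ENNReal}
    (hdrift : ∀ s, ∫⁻ x, V (f s x) ∂μ + g s ≤ V s + κ) :
    ∫⁻ ω, g (trajectory f s₀ (fun t => X t ω) (τ ω)) ∂P ≤ (T : ENNReal)⁻¹ * (V s₀ + T * κ) := by
  rw [lintegral_uniform_index (g := fun t x => g (trajectory f s₀ x t)) hτ
    (measurable_pi_iff.mpr hX) hunif hindep fun t => hg.comp (measurable_trajectory hf t),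
    Fintype.card_fin, ← Finset.sum_range fun t => ∫⁻ ω, g (trajectory f s₀ (fun j => X j ω) t) ∂P]
  exact mul_le_mul_right
    (le_add_self.trans (lintegral_trajectory_add_sum_le hf hX hind hlaw hV hg hdrift T)) _

end RandomRecursion

section Parameters

variable {α L ρ G σG σH Δ₀ r b : ℝ}

/-- The common scale `(n / (B T))^{1/5}` of the step size and the momentum factor. -/
def scale (B n T : ℕ) : ℝ := ((n : ℝ) / (B * T)) ^ (1 / 5 : ℝ)

theorem scale_pow (B n T k : ℕ) : scale B n T ^ k = ((n : ℝ) / (B * T)) ^ ((k : ℝ) / 5) := by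
  rw [scale, ← Real.rpow_mul_natCast (by positivity)]
  congr 1
  ring

theorem scale_pow_five (B n T : ℕ) : scale B n T ^ 5 = (n : ℝ) / (B * T) := by
  rw [scale_pow]
  norm_num

theorem momentum_eq_scale_sq (B n T : ℕ) : momentum B n T = scale B n T ^ 2 := by
  rw [scale_pow, Real.div_rpow (by positivity) (by positivity),
    Real.mul_rpow (by positivity) (by positivity), momentum, Nat.cast_ofNat]

variable {B n T : ℕ}

theorem scale_pos (hB : 0 < B) (hn : 0 < n) (hT : 0 < T) : 0 < scale B n T := by
  unfold scale
  positivity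

theorem stepSize_eq_scale_cube_mul (hB : 0 < B) (hn : 0 < n) :
    stepSize B n T = scale B n T ^ 3 * (B / n) := by
  have hsplit : ∀ m : ℕ, 0 < m → (m : ℝ) ^ (2 / 5 : ℝ) * (m : ℝ) ^ (3 / 5 : ℝ) = m := by
    intro m hm
    rw [← Real.rpow_add (by positivity)]
    norm_num
  rw [scale_pow, Real.div_rpow (by positivity) (by positivity),
    Real.mul_rpow (by positivity) (by positivity), stepSize, Nat.cast_ofNat,
    div_mul_div_comm, mul_right_comm, ← div_div, ← div_div _ _ ((T : ℝ) ^ _)]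
  congr 1
  rw [div_eq_div_iff (by positivity) (by positivity)]
  linear_combination (n : ℝ) * hsplit B hB - (B : ℝ) * hsplit n hn

theorem mul_scale_le {M ε : ℝ} (hB : 0 < B) (hT : 0 < T) (hε : 0 < ε)
    (hM : M ^ 5 * n / (B * ε ^ 5) ≤ T) : M * scale B n T ≤ ε := by
  refine (Odd.strictMono_pow (by decide : Odd 5)).le_iff_le.mp ?_
  rw [div_le_iff₀ (by positivity)] at hM
  rw [mul_pow, scale_pow_five, ← mul_div_assoc, div_le_iff₀ (by positivity)]
  linear_combination hM

/-- The noise of one iteration relative to `η / 2 * r²`, where `r` is the scale of the step. -/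
def noiseConst (α L ρ G σG σH : ℝ) : ℝ :=
  4 * (biasConst α L * (α ^ 2 * σG ^ 2))
    + 2 * (adaptedSmoothness α L ρ G + 3 * (biasConst α L * (1 + α * L) ^ 2))
      * gradMomentBound α L G σG σH

theorem noiseConst_nonneg (hα : 0 ≤ α) (hL : 0 ≤ L) (hρ : 0 ≤ ρ) (hG : 0 ≤ G) :
    0 ≤ noiseConst α L ρ G σG σH := by
  have := biasConst_nonneg (α := α) (L := L)
  have := adaptedSmoothness_nonneg hα hL hρ hG
  have := gradMomentBound_nonneg (α := α) (L := L) (G := G) (σG := σG) (σH := σH)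
  unfold noiseConst
  positivity

theorem trackingWeight_drift_le {κ : ℝ} (hr : 0 ≤ r) (hκ : 0 ≤ κ) :
    r * κ * (1 + r ^ 2 * b / 2) * (1 - b * r ^ 2) + r ^ 3 * b * κ / 2 ≤ r * κ := by
  have hgain : 0 ≤ r * κ * (r ^ 4 * b ^ 2 / 2) := by positivity
  linear_combination hgain

theorem driftNoise_scale_le (hα : 0 ≤ α) (hL : 0 ≤ L) (hρ : 0 ≤ ρ) (hG : 0 ≤ G) (hr : 0 < r)
    (hr₁ : r ≤ 1) (hb : 0 < b) (hb₁ : b ≤ 1) :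
    driftNoise (r * biasConst α L * (1 + r ^ 2 * b / 2) * b)
        (adaptedSmoothness α L ρ G
          + r * biasConst α L * (1 + (r ^ 2 * b / 2)⁻¹) * (1 + α * L) ^ 2)
        α (r ^ 3 * b) (r ^ 2) L G σG σH ≤
      r ^ 3 * b / 2 * (r ^ 2 * noiseConst α L ρ G σG σH) := by
  have hM := gradMomentBound_nonneg (α := α) (L := L) (G := G) (σG := σG) (σH := σH)
  have hF := adaptedSmoothness_nonneg hα hL hρ hG
  have hκ := biasConst_nonneg (α := α) (L := L)
  unfold driftNoise noiseConst
  set κ := biasConst α L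
  have hr2 : r ^ 2 ≤ 1 := pow_le_one₀ hr.le hr₁
  have hr2b : r ^ 2 * b ≤ 1 := mul_le_one₀ hr2 hb.le hb₁
  have htracking : r ^ 3 * b * κ / 2 + r * κ * (1 + r ^ 2 * b / 2) * b ≤ 2 * (r * κ * b) := by
    have hscale : r * κ * b * (r ^ 2 / 2 + r ^ 2 * b / 2) ≤ r * κ * b * 1 := by
      gcongr
      linarith
    linear_combination hscale
  have hsmooth : adaptedSmoothness α L ρ G * (r ^ 3 * b) ^ 2 ≤
      adaptedSmoothness α L ρ G * (r ^ 5 * b) := by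
    have hrb : r * b ≤ 1 := mul_le_one₀ hr₁ hb.le hb₁
    have hscale : r ^ 5 * b * (r * b) ≤ r ^ 5 * b * 1 := by gcongr
    exact mul_le_mul_of_nonneg_left (by linear_combination hscale) hF
  have hmove : r * κ * (1 + (r ^ 2 * b / 2)⁻¹) * (1 + α * L) ^ 2 * (r ^ 3 * b) ^ 2 ≤
      3 * (κ * (1 + α * L) ^ 2) * (r ^ 5 * b) := by
    have hscale : κ * (1 + α * L) ^ 2 * (r ^ 5 * b) * (r ^ 2 * b + 2) ≤
        κ * (1 + α * L) ^ 2 * (r ^ 5 * b) * 3 := by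
      gcongr
      linarith
    calc _ = κ * (1 + α * L) ^ 2 * (r ^ 5 * b) * (r ^ 2 * b + 2) := by field_simp
      _ ≤ _ := hscale
      _ = _ := by ring
  calc _ ≤ 2 * (r * κ * b) * ((r ^ 2) ^ 2 * (α ^ 2 * σG ^ 2))
        + (adaptedSmoothness α L ρ G * (r ^ 5 * b)
          + 3 * (κ * (1 + α * L) ^ 2) * (r ^ 5 * b)) * gradMomentBound α L G σG σH := by
        rw [add_mul (adaptedSmoothness α L ρ G)]
        gcongr
    _ = _ := by ring

/-- The constant of the bound on the mean squared gradient. -/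
def rateConst (α L ρ G σG σH Δ₀ : ℝ) : ℝ :=
  2 * Δ₀ + 4 * (biasConst α L * (α ^ 2 * σG ^ 2)) + noiseConst α L ρ G σG σH

theorem rateConst_nonneg (hα : 0 ≤ α) (hL : 0 ≤ L) (hρ : 0 ≤ ρ) (hG : 0 ≤ G) (hΔ₀ : 0 ≤ Δ₀) :
    0 ≤ rateConst α L ρ G σG σH Δ₀ := by
  have := biasConst_nonneg (α := α) (L := L)
  have := noiseConst_nonneg (σG := σG) (σH := σH) hα hL hρ hG
  unfold rateConst
  positivity

end Parameters

section Convergence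

theorem integrable_of_lintegral_ofReal_le {Ω : Type*} [MeasurableSpace Ω] {P : Measure Ω}
    {f : Ω → ℝ} {b : ℝ} (hf : AEStronglyMeasurable f P) (hf₀ : 0 ≤ f) (hb : 0 ≤ b)
    (hle : ∫⁻ ω, ENNReal.ofReal (f ω) ∂P ≤ ENNReal.ofReal b) :
    Integrable f P ∧ ∫ ω, f ω ∂P ≤ b := by
  refine ⟨⟨hf, ?_⟩, ?_⟩
  · rw [hasFiniteIntegral_iff_ofReal (.of_forall hf₀)]
    exact hle.trans_lt ENNReal.ofReal_lt_top
  · rw [integral_eq_lintegral_of_nonneg_ae (.of_forall hf₀) hf]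
    exact ENNReal.toReal_le_of_le_ofReal hb hle

theorem integrable_of_integral_sq_le {Ω : Type*} [MeasurableSpace Ω] {P : Measure Ω}
    [IsProbabilityMeasure P] {f : Ω → ℝ} {b : ℝ} (hf : AEStronglyMeasurable f P)
    (hf_sq : Integrable (fun ω => f ω ^ 2) P) (hb : 0 ≤ b) (hle : ∫ ω, f ω ^ 2 ∂P ≤ b ^ 2) :
    Integrable f P ∧ ∫ ω, f ω ∂P ≤ b := by
  have hL2 : MemLp f 2 P := (memLp_two_iff_integrable_sq hf).mpr hf_sq
  have hvar : 0 ≤ ∫ ω, f ω ^ 2 ∂P - (∫ ω, f ω ∂P) ^ 2 := by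
    have := variance_nonneg f P
    rwa [variance_eq_sub hL2] at this
  exact ⟨hL2.integrable one_le_two,
    (abs_le_of_sq_le_sq' ((sub_nonneg.mp hvar).trans hle) hb).2⟩

variable {d n B K T : ℕ} {Z : Type*} {α η β L ρ G σG σH A r Δ₀ : ℝ}
  {ℓ : Fin n → Vec d → Z → ℝ}

theorem run_eq_trajectory (w₀ : Vec d) (x : ℕ → StepSample n B K Z) (t : ℕ) :
    run α η β ℓ w₀ x t = trajectory (step α η β ℓ) ⟨w₀, 0, ∅⟩ x t := by
  induction t with
  | zero => rfl
  | succ t ih => rw [run, trajectory, ih]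

variable [MeasurableSpace Z] {D : Fin n → Measure Z}

theorem potential_init (hn : 0 < n) (w₀ : Vec d) :
    potential A α σG ℓ D ⟨w₀, 0, ∅⟩ =
      metaObjective α ℓ D w₀ - (⨅ w, metaObjective α ℓ D w) + A * (2 * (α ^ 2 * σG ^ 2)) := by
  simp only [potential, meanTaskError, taskError, Finset.notMem_empty, if_false, Finset.sum_const,
    Finset.card_univ, Fintype.card_fin, nsmul_eq_mul]
  rw [inv_mul_cancel_left₀ (by positivity)]

variable [∀ i, IsProbabilityMeasure (D i)]

theorem Assumptions.lintegral_potential_step_le (h : Assumptions α L ρ G σG σH ℓ D) (hB : 0 < B)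
    (hBn : B ≤ n) (hK : 0 < K) (hα : 0 ≤ α) (hL : 0 ≤ L) (hρ : 0 ≤ ρ) (hG : 0 ≤ G) (hr : 0 < r)
    (hr₁ : r ≤ 1) (hη : η = r ^ 3 * (B / n)) (s : State d n) :
    ∫⁻ x, ENNReal.ofReal (potential (r * biasConst α L) α σG ℓ D (step α η (r ^ 2) ℓ s x))
          ∂(stepLaw B K D)
        + ENNReal.ofReal (η / 2 * ‖∇ (metaObjective α ℓ D) s.w‖ ^ 2) ≤
      ENNReal.ofReal (potential (r * biasConst α L) α σG ℓ D s)
        + ENNReal.ofReal (η / 2 * (r ^ 2 * noiseConst α L ρ G σG σH)) := by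
  have hn : 0 < n := hB.trans_le hBn
  have hA : 0 ≤ r * biasConst α L := mul_nonneg hr.le biasConst_nonneg
  have hη₀ : 0 ≤ η := hη ▸ by positivity
  have hBn' : (B / n : ℝ) ≤ 1 := (div_le_one (by positivity)).mpr (Nat.cast_le.mpr hBn)
  obtain ⟨hint, hle⟩ := h.integral_potential_step_le (K := K) hB hBn hK hα hL hρ hG hη₀
    (sq_nonneg r) (pow_le_one₀ hr.le hr₁) hA (c := r ^ 2 * (B / n) / 2) (by positivity)
    (hη ▸ trackingWeight_drift_le hr.le biasConst_nonneg) s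
  have hnoise := driftNoise_scale_le (σG := σG) (σH := σH) (b := B / n) hα hL hρ hG hr hr₁
    (by positivity) hBn'
  rw [← hη] at hnoise
  rw [← ofReal_integral_eq_lintegral_ofReal hint (.of_forall fun x => h.potential_nonneg hA _),
    ← ENNReal.ofReal_add (integral_nonneg fun x => h.potential_nonneg hA _) (by positivity)]
  exact (ENNReal.ofReal_le_ofReal (hle.trans (by gcongr))).trans ENNReal.ofReal_add_le

variable {Ω : Type*} [MeasurableSpace Ω] {P : Measure Ω} [IsProbabilityMeasure P]
  {X : ℕ → Ω → StepSample n B K Z} {τ : Ω → Fin T} {w₀ : Vec d}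

theorem Assumptions.lintegral_gradient_sq_le (h : Assumptions α L ρ G σG σH ℓ D) (hB : 0 < B)
    (hBn : B ≤ n) (hK : 0 < K) (hα : 0 ≤ α) (hL : 0 ≤ L) (hρ : 0 ≤ ρ) (hG : 0 ≤ G) (hT : 0 < T)
    (hr₁ : scale B n T ≤ 1) (hΔ : metaObjective α ℓ D w₀ - ⨅ w, metaObjective α ℓ D w ≤ Δ₀)
    (hη : η = scale B n T ^ 3 * (B / n)) (hX : ∀ t, Measurable (X t)) (hind : iIndepFun X P)
    (hlaw : ∀ t, P.map (X t) = stepLaw B K D) (hτ : Measurable τ)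
    (hunif : P.map τ = uniformOn Set.univ) (hindep : IndepFun τ (fun ω t => X t ω) P) :
    ∫⁻ ω, ENNReal.ofReal (η / 2 * ‖∇ (metaObjective α ℓ D) (run α η (scale B n T ^ 2) ℓ w₀
        (fun t => X t ω) (τ ω)).w‖ ^ 2) ∂P ≤
      ENNReal.ofReal (η / 2 * (scale B n T ^ 2 * rateConst α L ρ G σG σH Δ₀)) := by
  have hn : 0 < n := hB.trans_le hBn
  have hr := scale_pos hB hn hT
  have hr5 := scale_pow_five B n T
  set r := scale B n T
  have hκ := biasConst_nonneg (α := α) (L := L)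
  have hA : 0 ≤ r * biasConst α L := mul_nonneg hr.le hκ
  have hη₀ : 0 ≤ η := hη ▸ by positivity
  have hnoise := noiseConst_nonneg (σG := σG) (σH := σH) hα hL hρ hG
  have hgrad : Measurable fun s : State d n =>
      ENNReal.ofReal (η / 2 * ‖∇ (metaObjective α ℓ D) s.w‖ ^ 2) :=
    (((h.continuous_gradient_metaObjective.measurable.comp measurable_state_w).norm.pow_const
      2).const_mul _).ennreal_ofReal
  have hrate := lintegral_trajectory_uniform_le (s₀ := ⟨w₀, 0, ∅⟩)
    (h.measurable_step (η := η) (β := r ^ 2)) hX hind hlaw hτ hunif hindep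
    h.measurable_potential.ennreal_ofReal hgrad
    (h.lintegral_potential_step_le hB hBn hK hα hL hρ hG hr hr₁ hη)
  simp only [← run_eq_trajectory] at hrate
  refine hrate.trans ?_
  have hinit : potential (r * biasConst α L) α σG ℓ D ⟨w₀, 0, ∅⟩ ≤
      Δ₀ + biasConst α L * (2 * (α ^ 2 * σG ^ 2)) := by
    rw [potential_init hn]
    gcongr
    exact mul_le_of_le_one_left hκ hr₁
  have hηT : T * (η * r ^ 2) = 1 := by
    rw [hη, show r ^ 3 * (B / n : ℝ) * r ^ 2 = r ^ 5 * (B / n) by ring, hr5]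
    field_simp
  rw [← ENNReal.ofReal_natCast, ← ENNReal.ofReal_inv_of_pos (by positivity),
    ← ENNReal.ofReal_mul (by positivity), ← ENNReal.ofReal_add (h.potential_nonneg hA _)
      (by positivity), ← ENNReal.ofReal_mul (by positivity)]
  refine ENNReal.ofReal_le_ofReal ?_
  rw [inv_mul_le_iff₀ (by positivity), rateConst]
  linear_combination hinit + (-(Δ₀ + 2 * (biasConst α L * (α ^ 2 * σG ^ 2)))) * hηT

theorem Assumptions.integral_norm_gradient_le (h : Assumptions α L ρ G σG σH ℓ D) (hB : 0 < B)
    (hBn : B ≤ n) (hK : 0 < K) (hα : 0 ≤ α) (hL : 0 ≤ L) (hρ : 0 ≤ ρ) (hG : 0 ≤ G) (hT : 0 < T)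
    (hr₁ : scale B n T ≤ 1) (hΔ₀ : 0 ≤ Δ₀)
    (hΔ : metaObjective α ℓ D w₀ - ⨅ w, metaObjective α ℓ D w ≤ Δ₀) {ε : ℝ} (hε : 0 ≤ ε)
    (hrate : scale B n T ^ 2 * rateConst α L ρ G σG σH Δ₀ ≤ ε ^ 2) (hX : ∀ t, Measurable (X t))
    (hind : iIndepFun X P) (hlaw : ∀ t, P.map (X t) = stepLaw B K D) (hτ : Measurable τ)
    (hunif : P.map τ = uniformOn Set.univ) (hindep : IndepFun τ (fun ω t => X t ω) P) :
    Integrable (fun ω => ‖∇ (metaObjective α ℓ D) (run α (stepSize B n T) (momentum B n T) ℓ w₀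
        (fun t => X t ω) (τ ω)).w‖) P ∧
      ∫ ω, ‖∇ (metaObjective α ℓ D) (run α (stepSize B n T) (momentum B n T) ℓ w₀
        (fun t => X t ω) (τ ω)).w‖ ∂P ≤ ε := by
  have hn : 0 < n := hB.trans_le hBn
  have hη := stepSize_eq_scale_cube_mul (T := T) hB hn
  have hη₀ : 0 < stepSize B n T / 2 := by
    have := scale_pos hB hn hT
    rw [hη]
    positivity
  have hR := rateConst_nonneg (σG := σG) (σH := σH) hα hL hρ hG hΔ₀
  have hlint := h.lintegral_gradient_sq_le hB hBn hK hα hL hρ hG hT hr₁ hΔ hη hX hind hlaw hτ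
    hunif hindep
  rw [momentum_eq_scale_sq]
  set Y : Ω → ℝ := fun ω => ‖∇ (metaObjective α ℓ D) (run α (stepSize B n T) (scale B n T ^ 2) ℓ
    w₀ (fun t => X t ω) (τ ω)).w‖ with hY
  have hYm : Measurable Y := by
    simp only [hY, run_eq_trajectory]
    exact (h.continuous_gradient_metaObjective.measurable.comp (measurable_state_w.comp
      (measurable_trajectory_index h.measurable_step hX hτ))).norm
  obtain ⟨hsq, hle⟩ := integrable_of_lintegral_ofReal_le
    ((hYm.pow_const 2).const_mul _).aestronglyMeasurable (fun ω => by positivity)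
    (by positivity) hlint
  rw [integrable_const_mul_iff (IsUnit.mk0 _ hη₀.ne')] at hsq
  rw [integral_const_mul] at hle
  exact integrable_of_integral_sq_le hYm.aestronglyMeasurable hsq hε
    ((le_of_mul_le_mul_left hle hη₀).trans hrate)

end Convergence

end MOML

end

theorem mainTheorem1_general (α L ρ G σG σH Δ₀ : ℝ) (hα : 0 ≤ α) (hL : 0 ≤ L) (hρ : 0 ≤ ρ)
    (hG : 0 ≤ G) (hΔ₀ : 0 ≤ Δ₀) :
    ∃ C : ℝ, 0 < C ∧
      ∀ (n B K : ℕ), 0 < B → B ≤ n → 0 < K →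
      ∀ (ε : ℝ), 0 < ε → ∀ (T : ℕ), C * n / (B * ε ^ 5) ≤ T →
        (ε ≤ 1 → MOML.momentum B n T < 1) ∧
        (MOML.momentum B n T < 1 →
          ∀ (d : ℕ) (Z : Type*) [MeasurableSpace Z]
            (D : Fin n → Measure Z) [∀ i, IsProbabilityMeasure (D i)]
            (ℓ : Fin n → MOML.Vec d → Z → ℝ),
            MOML.Assumptions α L ρ G σG σH ℓ D →
          ∀ (w₀ : MOML.Vec d),
            MOML.metaObjective α ℓ D w₀ - ⨅ w, MOML.metaObjective α ℓ D w ≤ Δ₀ →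
          ∀ (Ω : Type*) [MeasurableSpace Ω] (P : Measure Ω) [IsProbabilityMeasure P]
            (X : ℕ → Ω → MOML.StepSample n B K Z) (τ : Ω → Fin T),
            (∀ t, Measurable (X t)) → iIndepFun X P → (∀ t, P.map (X t) = MOML.stepLaw B K D) →
            Measurable τ → P.map τ = uniformOn Set.univ → IndepFun τ (fun ω t => X t ω) P →
          Integrable (fun ω => ‖∇ (MOML.metaObjective α ℓ D)
            (MOML.run α (MOML.stepSize B n T) (MOML.momentum B n T) ℓ w₀
              (fun t => X t ω) (τ ω)).w‖) P ∧
          ∫ ω, ‖∇ (MOML.metaObjective α ℓ D)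
            (MOML.run α (MOML.stepSize B n T) (MOML.momentum B n T) ℓ w₀
              (fun t => X t ω) (τ ω)).w‖ ∂P ≤ ε) := by
  have hR := MOML.rateConst_nonneg (σG := σG) (σH := σH) hα hL hρ hG hΔ₀
  set R := MOML.rateConst α L ρ G σG σH Δ₀
  refine ⟨(2 + R) ^ 5, by positivity, fun n B K hB hBn hK ε hε T hCT => ?_⟩
  have hn : 0 < n := hB.trans_le hBn
  have hT : 0 < T := Nat.cast_pos.mp (lt_of_lt_of_le (by positivity) hCT)
  have hr := MOML.scale_pos hB hn hT
  have hscale := MOML.mul_scale_le hB hT hε hCT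
  refine ⟨fun hε₁ => ?_, fun hβ d Z _ D _ ℓ h w₀ hΔ Ω _ P _ X τ hX hind hlaw hτ hunif hindep =>
    h.integral_norm_gradient_le hB hBn hK hα hL hρ hG hT ?_ hΔ₀ hΔ hε.le ?_ hX hind hlaw hτ
      hunif hindep⟩
  · have hr₁ : MOML.scale B n T < 1 := by nlinarith
    exact MOML.momentum_eq_scale_sq B n T ▸ pow_lt_one₀ hr.le hr₁ two_ne_zero
  · exact ((sq_lt_one_iff₀ hr.le).mp (MOML.momentum_eq_scale_sq B n T ▸ hβ)).le
  · have hsq := pow_le_pow_left₀ (by positivity) hscale 2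
    nlinarith [mul_nonneg (sq_nonneg (MOML.scale B n T)) (by positivity : 0 ≤ 4 + 3 * R + R ^ 2)]

/-- `C` depends only on `α, L, ρ, G, σG, σH` and on the bound `Δ₀` of the initial gap
`F(w₀) - inf F`. Every number of iterations `T ≥ C n ε⁻⁵` that is compatible with `β < 1` gives
`𝔼‖∇F(w_τ)‖ ≤ ε`, and `β < 1` is automatic for `ε ≤ 1`. -/
theorem mainTheorem1 (α L ρ G σG σH Δ₀ : ℝ) (hα : 0 < α) (hL : 0 ≤ L) (hρ : 0 ≤ ρ) (hG : 0 < G)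
    (hσG : 0 ≤ σG) (hσH : 0 ≤ σH) (hΔ₀ : 0 ≤ Δ₀) :
    ∃ C : ℝ, 0 < C ∧
      ∀ (n : ℕ), 0 < n → ∀ (ε : ℝ), 0 < ε → ∀ (T : ℕ), C * n / ε ^ 5 ≤ T →
        (ε ≤ 1 → MOML.momentum 1 n T < 1) ∧
        (MOML.momentum 1 n T < 1 →
          ∀ (d : ℕ) (Z : Type*) [MeasurableSpace Z]
            (D : Fin n → MeasureTheory.Measure Z)
            [∀ i, MeasureTheory.IsProbabilityMeasure (D i)]
            (ℓ : Fin n → MOML.Vec d → Z → ℝ),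
            MOML.Assumptions α L ρ G σG σH ℓ D →
          ∀ (w₀ : MOML.Vec d),
            MOML.metaObjective α ℓ D w₀ - ⨅ w, MOML.metaObjective α ℓ D w ≤ Δ₀ →
          ∀ (Ω : Type*) [MeasurableSpace Ω] (P : MeasureTheory.Measure Ω)
            [MeasureTheory.IsProbabilityMeasure P]
            -- the randomness of the iterations: independent, each with the law of one iteration
            (X : ℕ → Ω → MOML.StepSample n 1 1 Z)
            -- the index of the returned iterate: uniform on `0, …, T - 1` and independent of `X`
            (τ : Ω → Fin T),
            (∀ t, Measurable (X t)) →
            ProbabilityTheory.iIndepFun X P →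
            (∀ t, P.map (X t) = MOML.stepLaw 1 1 D) →
            Measurable τ →
            P.map τ = ProbabilityTheory.uniformOn Set.univ →
            ProbabilityTheory.IndepFun τ (fun ω t => X t ω) P →
          MeasureTheory.Integrable (fun ω => ‖gradient (MOML.metaObjective α ℓ D)
            (MOML.run α (MOML.stepSize 1 n T) (MOML.momentum 1 n T) ℓ w₀
              (fun t => X t ω) (τ ω)).w‖) P ∧
          ∫ ω, ‖gradient (MOML.metaObjective α ℓ D)
            (MOML.run α (MOML.stepSize 1 n T) (MOML.momentum 1 n T) ℓ w₀
              (fun t => X t ω) (τ ω)).w‖ ∂P ≤ ε) := by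
  obtain ⟨C, hC, hrate⟩ := mainTheorem1_general α L ρ G σG σH Δ₀ hα.le hL hρ hG.le hΔ₀
  exact ⟨C, hC, fun n hn ε hε T hT => hrate n 1 1 one_pos hn one_pos ε hε T (by simpa using hT)⟩
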